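/- Let $\Phi:[0,\infty]\to[0,\infty]$ be a Young function: $\Phi$ is nondecreasing, $\lim_{t\to0}\Phi(t)=\Phi(0)=0$, $a(\Phi)=\sup\{t\ge0:\Phi(t)=0\}<\infty$, $b(\Phi)=\inf\{t\ge0:\Phi(t)=\infty\}>0$, $\Phi$ is convex on $[0,b(\Phi))$, with $\lim_{t\to\infty}\Phi(t)=\Phi(\infty)=\infty$ if $b(\Phi)=\infty$, and $\lim_{t\to b(\Phi)-0}\Phi(t)=\Phi(b(\Phi))$ if $b(\Phi)<\infty$. Assume $\Phi\in\Delta_2$, i.e. for some finite $k>1$, $\Phi(2r)\le k\Phi(r)$ for all $r>0$. Put $\Phi^{-1}(u)=\inf\{t\ge0:\Phi(t)>u\}$ for $u\in[0,\infty)$, $\Phi^{-1}(\infty)=\infty$, and let $\widetilde\Phi(r)=\sup\{rs-\Phi(s):s\in[0,\infty)\}$ for $r\in[0,\infty)$, $\widetilde\Phi(\infty)=\infty$, be the complementary function. Let $n$ be a nonnegative integer and let $\mathbb K$ be $\mathbb R$ or $\mathbb C$. For a measurable $f:\mathbb R^n\to\mathbb K$ let $m(f,t)=|\{x:|f(x)|>t\}|$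 and $f^*(t)=\inf\{\alpha>0:m(f,\alpha)\le t\}$ (with $\inf\emptyset=\infty$). Let $L^{\Phi,1}(\mathbb R^n)$ be the space of (a.e. classes of) measurable functions $f$ with $$\|f\|_{L^{\Phi,1}}=\int_0^\infty\Phi^{-1}\left(\frac1t\right)^{-1}f^*(t)\,\frac{dt}{t}<\infty,$$ and let $wL^{\widetilde\Phi}(\mathbb R^n)$ be the space of (a.e. classes of) measurable functions $g$ such that $\sup_{t>0}\widetilde\Phi(t)\,m(kg,t)<\infty$ for some $k>0$, with $$\|g\|_{wL^{\widetilde\Phi}}=\inf\left\{\lambda>0:\sup_{t>0}\widetilde\Phi(t)\,m(g/\lambda,t)\le1\right\}.$$ Let $L^{\Phi,1}(\mathbb R^n)^*$ be the space of linear functionals $T:L^{\Phi,1}(\mathbb R^n)\to\mathbb K$ for which there is a finite $C$ with $|Tf|\le C\|f\|_{L^{\Phi,1}}$ for all $f$, and let $\|T\|$ be the infimum of all such $C$. Then $L^{\Phi,1}(\mathbb R^n)^*=wL^{\widetilde\Phi}(\mathbb R^n)$ with equivalence of quasi-norms. That is: for all $f\in L^{\Phi,1}(\mathbb R^n)$ and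 $g\in wL^{\widetilde\Phi}(\mathbb R^n)$ the product $fg$ is integrable; the map $g\mapsto T_g$, $T_g(f)=\int_{\mathbb R^n}f(x)g(x)\,dx$, is a linear bijection from $wL^{\widetilde\Phi}(\mathbb R^n)$ onto $L^{\Phi,1}(\mathbb R^n)^*$; and there are constants $0<c,C<\infty$ such that $c\,\|g\|_{wL^{\widetilde\Phi}}\le\|T_g\|\le C\,\|g\|_{wL^{\widetilde\Phi}}$ for all $g\in wL^{\widetilde\Phi}(\mathbb R^n)$. -/

import Mathlib

open MeasureTheory Set Filter Topology
open scoped ENNReal NNReal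

/-- `a(Φ) = sup {t ≥ 0 : Φ(t) = 0}`. -/
noncomputable def youngA (Φ : ℝ≥0∞ → ℝ≥0∞) : ℝ≥0∞ := sSup {t | Φ t = 0}

/-- `b(Φ) = inf {t ≥ 0 : Φ(t) = ∞}`. -/
noncomputable def youngB (Φ : ℝ≥0∞ → ℝ≥0∞) : ℝ≥0∞ := sInf {t | Φ t = ∞}

/-- Young functions `Φ : [0,∞] → [0,∞]`. -/
structure IsYoungFunction (Φ : ℝ≥0∞ → ℝ≥0∞) : Prop where
  monotone : Monotone Φ
  a_lt_top : youngA Φ < ∞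
  b_pos : 0 < youngB Φ
  map_zero : Φ 0 = 0
  tendsto_zero : Tendsto Φ (𝓝[>] 0) (𝓝 0)
  convexOn : ConvexOn ℝ≥0 (Iio (youngB Φ)) Φ
  of_b_eq_top : youngB Φ = ∞ → Tendsto Φ (𝓝[<] ∞) (𝓝 ∞) ∧ Φ ∞ = ∞
  of_b_lt_top : youngB Φ < ∞ → Tendsto Φ (𝓝[<] (youngB Φ)) (𝓝 (Φ (youngB Φ)))

/-- The `Δ₂`-condition: `Φ(2r) ≤ k Φ(r)` for all `r > 0`, for some (finite) `k > 1`. -/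
def DeltaTwo (Φ : ℝ≥0∞ → ℝ≥0∞) : Prop :=
  ∃ k : ℝ≥0, 1 < k ∧ ∀ r : ℝ≥0∞, 0 < r → Φ (2 * r) ≤ k * Φ r

/-- The generalized inverse `Φ⁻¹(u) = inf {t ≥ 0 : Φ(t) > u}`; for `u = ∞` the set is empty and
the value is `∞`. -/
noncomputable def youngInv (Φ : ℝ≥0∞ → ℝ≥0∞) (u : ℝ≥0∞) : ℝ≥0∞ := sInf {t | u < Φ t}

/-- The complementary function `Φ̃(r) = sup {r s - Φ(s) : 0 ≤ s < ∞}` for `r < ∞`, and `Φ̃(∞) = ∞`.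
The subtraction is truncated at `0`, which does not change the supremum for a Young function,
as `s = 0` contributes `0`. -/
noncomputable def complementaryFunction (Φ : ℝ≥0∞ → ℝ≥0∞) (r : ℝ≥0∞) : ℝ≥0∞ :=
  open scoped Classical in if r = ∞ then ∞ else ⨆ s : ℝ≥0, (r * s - Φ s)

section Rearrangement

variable {n : ℕ} {𝕜 : Type*} [RCLike 𝕜]

/-- The distribution function `m(f,t) = |{x ∈ ℝⁿ : |f(x)| > t}|`. -/
noncomputable def distribFun (f : EuclideanSpace ℝ (Fin n) → 𝕜) (t : ℝ≥0) : ℝ≥0∞ :=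
  volume {x | t < ‖f x‖₊}

/-- The decreasing rearrangement `f*(t) = inf {α > 0 : m(f,α) ≤ t}`, with `inf ∅ = ∞`. -/
noncomputable def rearrangement (f : EuclideanSpace ℝ (Fin n) → 𝕜) (t : ℝ≥0∞) : ℝ≥0∞ :=
  ⨅ (α : ℝ≥0) (_ : 0 < α ∧ distribFun f α ≤ t), (α : ℝ≥0∞)

/-- `‖f‖_{L^{Φ,1}} = ∫₀^∞ Φ⁻¹(1/t)⁻¹ f*(t) dt/t`. -/
noncomputable def orliczLorentzNorm (Φ : ℝ≥0∞ → ℝ≥0∞) (f : EuclideanSpace ℝ (Fin n) → 𝕜) :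
    ℝ≥0∞ :=
  ∫⁻ t in Ioi (0 : ℝ), (youngInv Φ (1 / ENNReal.ofReal t))⁻¹ *
    rearrangement f (ENNReal.ofReal t) / ENNReal.ofReal t

/-- `‖f‖_{wL^Φ} = inf {λ > 0 : sup_{t>0} Φ(t) m(f/λ,t) ≤ 1}`. -/
noncomputable def weakOrliczNorm (Φ : ℝ≥0∞ → ℝ≥0∞) (f : EuclideanSpace ℝ (Fin n) → 𝕜) :
    ℝ≥0∞ :=
  ⨅ (l : ℝ≥0) (_ : 0 < l ∧
    (⨆ (t : ℝ≥0) (_ : 0 < t), Φ t * distribFun (fun x => f x / ((l : ℝ) : 𝕜)) t) ≤ 1), (l : ℝ≥0∞)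

/-- Membership in `wL^Φ`: `sup_{t>0} Φ(t) m(kf,t) < ∞` for some `k > 0`. -/
def MemWeakOrlicz (Φ : ℝ≥0∞ → ℝ≥0∞) (f : EuclideanSpace ℝ (Fin n) → 𝕜) : Prop :=
  ∃ k : ℝ, 0 < k ∧
    (⨆ (t : ℝ≥0) (_ : 0 < t), Φ t * distribFun (fun x => (k : 𝕜) * f x) t) < ∞

theorem distribFun_congr {f g : EuclideanSpace ℝ (Fin n) → 𝕜} (h : f =ᵐ[volume] g) (t : ℝ≥0) :
    distribFun f t = distribFun g t := by
  unfold distribFun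
  apply measure_congr
  filter_upwards [h] with x hx
  apply propext
  change t < ‖f x‖₊ ↔ t < ‖g x‖₊
  rw [hx]

theorem rearrangement_congr {f g : EuclideanSpace ℝ (Fin n) → 𝕜} (h : f =ᵐ[volume] g) :
    rearrangement f = rearrangement g := by
  funext t
  simp only [rearrangement, distribFun_congr h]

theorem orliczLorentzNorm_congr (Φ : ℝ≥0∞ → ℝ≥0∞) {f g : EuclideanSpace ℝ (Fin n) → 𝕜}
    (h : f =ᵐ[volume] g) : orliczLorentzNorm Φ f = orliczLorentzNorm Φ g := by
  simp only [orliczLorentzNorm, rearrangement_congr h]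

theorem memWeakOrlicz_congr (Φ : ℝ≥0∞ → ℝ≥0∞) {f g : EuclideanSpace ℝ (Fin n) → 𝕜}
    (h : f =ᵐ[volume] g) (hf : MemWeakOrlicz Φ f) : MemWeakOrlicz Φ g := by
  obtain ⟨k, hk, hf⟩ := hf
  refine ⟨k, hk, ?_⟩
  have h' : (fun x => (k : 𝕜) * f x) =ᵐ[volume] fun x => (k : 𝕜) * g x := by
    filter_upwards [h] with x hx
    rw [hx]
  simpa only [distribFun_congr h'] using hf

theorem distribFun_zero (t : ℝ≥0) :
    distribFun (fun _ : EuclideanSpace ℝ (Fin n) => (0 : 𝕜)) t = 0 := by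
  simp [distribFun]

theorem rearrangement_zero (t : ℝ≥0∞) :
    rearrangement (fun _ : EuclideanSpace ℝ (Fin n) => (0 : 𝕜)) t = 0 := by
  refine le_antisymm (ENNReal.le_of_forall_pos_le_add fun ε hε _ => ?_) zero_le
  rw [zero_add]
  exact iInf₂_le ε ⟨hε, by simp [distribFun_zero]⟩

theorem rearrangement_antitone (f : EuclideanSpace ℝ (Fin n) → 𝕜) :
    Antitone (rearrangement f) := fun _ _ hst =>
  le_iInf₂ fun α hα => iInf₂_le α ⟨hα.1, hα.2.trans hst⟩

theorem distribFun_add_le (f g : EuclideanSpace ℝ (Fin n) → 𝕜) (s t : ℝ≥0) :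
    distribFun (fun x => f x + g x) (s + t) ≤ distribFun f s + distribFun g t := by
  refine (measure_mono ?_).trans (measure_union_le _ _)
  intro x hx
  by_contra h
  simp only [mem_union, mem_ofPred_eq, not_or, not_lt] at h hx
  exact absurd ((nnnorm_add_le _ _).trans (add_le_add h.1 h.2)) (not_le.2 hx)

theorem rearrangement_add_le (f g : EuclideanSpace ℝ (Fin n) → 𝕜) (s t : ℝ≥0∞) :
    rearrangement (fun x => f x + g x) (s + t) ≤ rearrangement f s + rearrangement g t := by
  have key : ∀ α β : ℝ≥0, 0 < α ∧ distribFun f α ≤ s → 0 < β ∧ distribFun g β ≤ t →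
      rearrangement (fun x => f x + g x) (s + t) ≤ (α : ℝ≥0∞) + β := by
    intro α β hα hβ
    rw [← ENNReal.coe_add]
    exact iInf₂_le (α + β)
      ⟨add_pos hα.1 hβ.1, (distribFun_add_le f g α β).trans (add_le_add hα.2 hβ.2)⟩
  conv_rhs => unfold rearrangement
  simp only [ENNReal.iInf_add, ENNReal.add_iInf, le_iInf_iff]
  intros
  apply key <;> assumption

theorem rearrangement_const_mul_le (c : 𝕜) (f : EuclideanSpace ℝ (Fin n) → 𝕜) (t : ℝ≥0∞) :
    rearrangement (fun x => c * f x) t ≤ ‖c‖₊ * rearrangement f t := by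
  rcases eq_or_ne c 0 with rfl | hc
  · simp [rearrangement_zero]
  have hc' : 0 < ‖c‖₊ := nnnorm_pos.2 hc
  unfold rearrangement
  rw [ENNReal.mul_iInf_of_ne (by simpa using hc) ENNReal.coe_ne_top]
  refine le_iInf fun α => ?_
  rw [ENNReal.mul_iInf_of_ne (by simpa using hc) ENNReal.coe_ne_top]
  refine le_iInf fun hα => ?_
  rw [← ENNReal.coe_mul]
  refine iInf₂_le (‖c‖₊ * α) ⟨mul_pos hc' hα.1, le_trans (le_of_eq ?_) hα.2⟩
  unfold distribFun
  congr 1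
  ext x
  simp only [mem_ofPred_eq, nnnorm_mul]
  exact mul_lt_mul_iff_right₀ hc'

theorem youngInv_mono (Φ : ℝ≥0∞ → ℝ≥0∞) : Monotone (youngInv Φ) := fun _ _ huv =>
  sInf_le_sInf fun _ ht => lt_of_le_of_lt huv ht

theorem IsYoungFunction.youngInv_two_mul_le {Φ : ℝ≥0∞ → ℝ≥0∞} (hΦ : IsYoungFunction Φ)
    (u : ℝ≥0∞) : youngInv Φ (2 * u) ≤ 2 * youngInv Φ u := by
  have key : ∀ t, u < Φ t → youngInv Φ (2 * u) ≤ 2 * t := by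
    intro t ht
    rcases lt_or_ge (2 * t) (youngB Φ) with hb | hb
    · refine sInf_le ?_
      have h2 : (2 : ℝ≥0)⁻¹ + (2 : ℝ≥0)⁻¹ = 1 := by
        rw [← two_mul]
        exact mul_inv_cancel₀ two_ne_zero
      have h := hΦ.convexOn.2 (x := 0) hΦ.b_pos (y := 2 * t) hb
        (zero_le (a := (2 : ℝ≥0)⁻¹)) zero_le h2
      have e2 : ((2⁻¹ : ℝ≥0) : ℝ≥0∞) = 2⁻¹ := by
        rw [ENNReal.coe_inv two_ne_zero]
        rfl
      have e1 : ∀ y : ℝ≥0∞, (2 : ℝ≥0)⁻¹ • y = 2⁻¹ * y := fun y => by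
        rw [ENNReal.smul_def, e2, smul_eq_mul]
      rw [e1, e1, e1, e1, hΦ.map_zero, mul_zero, zero_add, zero_add, ← mul_assoc,
        ENNReal.inv_mul_cancel two_ne_zero ENNReal.ofNat_ne_top, one_mul] at h
      change 2 * u < Φ (2 * t)
      calc 2 * u < 2 * Φ t := by
            exact ENNReal.mul_lt_mul_right two_ne_zero ENNReal.ofNat_ne_top ht
        _ ≤ 2 * (2⁻¹ * Φ (2 * t)) := by gcongr
        _ = Φ (2 * t) := by
            rw [← mul_assoc, ENNReal.mul_inv_cancel two_ne_zero ENNReal.ofNat_ne_top, one_mul]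
    · refine le_of_forall_gt_imp_ge_of_dense fun s hs => sInf_le ?_
      obtain ⟨r, hr, hrs⟩ := sInf_lt_iff.1 (lt_of_le_of_lt hb hs)
      have hs' : Φ s = ∞ := top_le_iff.1 (hr ▸ hΦ.monotone hrs.le)
      change 2 * u < Φ s
      rw [hs']
      exact ENNReal.mul_lt_top ENNReal.ofNat_lt_top (ht.trans_le le_top)
  conv_rhs => rw [youngInv, sInf_eq_iInf]
  simp only [ENNReal.mul_iInf_of_ne two_ne_zero ENNReal.ofNat_ne_top]
  exact le_iInf₂ fun t ht => key t ht

theorem measurable_orliczLorentz_integrand (Φ : ℝ≥0∞ → ℝ≥0∞)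
    (f : EuclideanSpace ℝ (Fin n) → 𝕜) :
    Measurable fun t : ℝ => (youngInv Φ (1 / ENNReal.ofReal t))⁻¹ *
      rearrangement f (ENNReal.ofReal t) / ENNReal.ofReal t := by
  have h1 : Measurable (youngInv Φ) := (youngInv_mono Φ).measurable
  have h2 : Measurable (rearrangement f) := (rearrangement_antitone f).measurable
  fun_prop

theorem orliczLorentzNorm_add_le {Φ : ℝ≥0∞ → ℝ≥0∞} (hΦ : IsYoungFunction Φ)
    (f g : EuclideanSpace ℝ (Fin n) → 𝕜) :
    orliczLorentzNorm Φ (fun x => f x + g x)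
      ≤ 2 * (orliczLorentzNorm Φ f + orliczLorentzNorm Φ g) := by
  let H : (EuclideanSpace ℝ (Fin n) → 𝕜) → ℝ → ℝ≥0∞ := fun f t =>
    (youngInv Φ (1 / ENNReal.ofReal t))⁻¹ *
      rearrangement f (ENNReal.ofReal t) / ENNReal.ofReal t
  have hmeas : ∀ f, Measurable (H f) := measurable_orliczLorentz_integrand Φ
  have hscale : ∀ f, ∫⁻ t in Ioi (0 : ℝ), H f (2⁻¹ * t) = 2 * ∫⁻ t in Ioi (0 : ℝ), H f t := by
    intro f
    rw [← lintegral_indicator measurableSet_Ioi, ← lintegral_indicator measurableSet_Ioi]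
    have e : (fun t : ℝ => (Ioi (0 : ℝ)).indicator (fun t => H f (2⁻¹ * t)) t)
        = fun t => (Ioi (0 : ℝ)).indicator (H f) (2⁻¹ * t) := by
      funext t
      simp only [indicator, mem_Ioi]
      congr 1
      simp
    rw [e, ← lintegral_map ((hmeas f).indicator measurableSet_Ioi) (by fun_prop),
      Real.map_volume_mul_left (by norm_num), lintegral_smul_measure]
    simp
  have hpt : ∀ t ∈ Ioi (0 : ℝ), H (fun x => f x + g x) t ≤ H f (2⁻¹ * t) + H g (2⁻¹ * t) := by
    intro t ht
    have ht0 : ENNReal.ofReal t ≠ 0 := by simpa using ht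
    have htt : ENNReal.ofReal t ≠ ∞ := ENNReal.ofReal_ne_top
    have e : ENNReal.ofReal (2⁻¹ * t) = 2⁻¹ * ENNReal.ofReal t := by
      rw [ENNReal.ofReal_mul (by norm_num), ENNReal.ofReal_inv_of_pos (by norm_num)]
      simp
    simp only [H, e]
    set T := ENNReal.ofReal t
    have hT : T = 2⁻¹ * T + 2⁻¹ * T := by
      rw [← add_mul, ENNReal.inv_two_add_inv_two, one_mul]
    have hr : rearrangement (fun x => f x + g x) T
        ≤ rearrangement f (2⁻¹ * T) + rearrangement g (2⁻¹ * T) := by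
      conv_lhs => rw [hT]
      exact rearrangement_add_le f g _ _
    have hinv : (2⁻¹ * T)⁻¹ = 2 * T⁻¹ := by
      rw [ENNReal.mul_inv (by simp) (by simp), inv_inv]
    have hφ : (youngInv Φ (1 / T))⁻¹ ≤ 2 * (youngInv Φ (1 / (2⁻¹ * T)))⁻¹ := by
      rw [one_div, one_div, hinv]
      have h := ENNReal.inv_le_inv.2 (hΦ.youngInv_two_mul_le T⁻¹)
      rw [ENNReal.mul_inv (by simp) (by simp)] at h
      calc (youngInv Φ T⁻¹)⁻¹ = 2 * (2⁻¹ * (youngInv Φ T⁻¹)⁻¹) := by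
            rw [← mul_assoc, ENNReal.mul_inv_cancel two_ne_zero ENNReal.ofNat_ne_top, one_mul]
        _ ≤ _ := by gcongr
    calc _ ≤ (2 * (youngInv Φ (1 / (2⁻¹ * T)))⁻¹)
          * (rearrangement f (2⁻¹ * T) + rearrangement g (2⁻¹ * T)) / T := by gcongr
      _ = _ := by
        simp only [div_eq_mul_inv, hinv]
        ring
  calc orliczLorentzNorm Φ (fun x => f x + g x)
      ≤ ∫⁻ t in Ioi (0 : ℝ), (H f (2⁻¹ * t) + H g (2⁻¹ * t)) :=
        setLIntegral_mono' measurableSet_Ioi hpt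
    _ = 2 * (orliczLorentzNorm Φ f + orliczLorentzNorm Φ g) := by
        have hm : Measurable fun t : ℝ => H f (2⁻¹ * t) :=
          (hmeas f).comp (measurable_const_mul (2⁻¹ : ℝ))
        rw [lintegral_add_left hm, hscale, hscale, mul_add]
        rfl

theorem orliczLorentzNorm_const_mul_le (Φ : ℝ≥0∞ → ℝ≥0∞) (c : 𝕜)
    (f : EuclideanSpace ℝ (Fin n) → 𝕜) :
    orliczLorentzNorm Φ (fun x => c * f x) ≤ ‖c‖₊ * orliczLorentzNorm Φ f := by
  unfold orliczLorentzNorm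
  rw [← lintegral_const_mul _ (measurable_orliczLorentz_integrand Φ f)]
  refine lintegral_mono fun t => ?_
  calc _ ≤ (youngInv Φ (1 / ENNReal.ofReal t))⁻¹ *
        (‖c‖₊ * rearrangement f (ENNReal.ofReal t)) / ENNReal.ofReal t := by
        gcongr
        exact rearrangement_const_mul_le c f _
    _ = _ := by
        simp only [div_eq_mul_inv]
        ring

theorem orliczLorentzNorm_zero (Φ : ℝ≥0∞ → ℝ≥0∞) :
    orliczLorentzNorm Φ (fun _ : EuclideanSpace ℝ (Fin n) => (0 : 𝕜)) = 0 := by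
  simp [orliczLorentzNorm, rearrangement_zero]

theorem distribFun_mono {f g : EuclideanSpace ℝ (Fin n) → 𝕜} (h : ∀ x, ‖f x‖ ≤ ‖g x‖) (t : ℝ≥0) :
    distribFun f t ≤ distribFun g t :=
  measure_mono fun x (hx : t < ‖f x‖₊) => lt_of_lt_of_le hx (h x)

theorem MemWeakOrlicz.add {Φ : ℝ≥0∞ → ℝ≥0∞} {f g : EuclideanSpace ℝ (Fin n) → 𝕜}
    (hf : MemWeakOrlicz Φ f) (hg : MemWeakOrlicz Φ g) : MemWeakOrlicz Φ fun x => f x + g x := by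
  obtain ⟨k, hk, hf⟩ := hf
  obtain ⟨l, hl, hg⟩ := hg
  have hm : 0 < min k l := lt_min hk hl
  refine ⟨min k l / 2, half_pos hm, lt_of_le_of_lt ?_ (ENNReal.add_lt_top.2 ⟨hf, hg⟩)⟩
  refine iSup₂_le fun t ht => ?_
  refine le_trans ?_ (add_le_add (le_iSup₂ (f := fun (t : ℝ≥0) (_ : 0 < t) =>
    Φ t * distribFun (fun x => (k : 𝕜) * f x) t) t ht) (le_iSup₂ (f := fun (t : ℝ≥0) (_ : 0 < t) =>
    Φ t * distribFun (fun x => (l : 𝕜) * g x) t) t ht))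
  rw [← mul_add]
  gcongr
  refine (measure_mono ?_).trans (measure_union_le _ _)
  intro x hx
  by_contra h
  simp only [mem_union, mem_ofPred_eq, not_or, not_lt, ← NNReal.coe_lt_coe,
    coe_nnnorm, norm_mul, RCLike.norm_ofReal, abs_of_pos hk, abs_of_pos hl,
    abs_of_pos (half_pos hm)] at h hx
  have h1 := mul_le_mul_of_nonneg_right (min_le_left k l) (norm_nonneg (f x))
  have h2 := mul_le_mul_of_nonneg_right (min_le_right k l) (norm_nonneg (g x))
  have h3 := mul_le_mul_of_nonneg_left (norm_add_le (f x) (g x)) hm.le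
  linarith

theorem MemWeakOrlicz.zero (Φ : ℝ≥0∞ → ℝ≥0∞) :
    MemWeakOrlicz Φ (fun _ : EuclideanSpace ℝ (Fin n) => (0 : 𝕜)) :=
  ⟨1, one_pos, by simp [distribFun_zero]⟩

theorem MemWeakOrlicz.const_mul {Φ : ℝ≥0∞ → ℝ≥0∞} {f : EuclideanSpace ℝ (Fin n) → 𝕜} (c : 𝕜)
    (hf : MemWeakOrlicz Φ f) : MemWeakOrlicz Φ fun x => c * f x := by
  rcases eq_or_ne c 0 with rfl | hc
  · simpa using MemWeakOrlicz.zero Φ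
  obtain ⟨k, hk, hf⟩ := hf
  have hc' : 0 < ‖c‖ := norm_pos_iff.2 hc
  refine ⟨k / ‖c‖, div_pos hk hc', lt_of_le_of_lt ?_ hf⟩
  refine iSup₂_mono fun t _ => ?_
  gcongr
  refine distribFun_mono (fun x => le_of_eq ?_) t
  rw [norm_mul, norm_mul, norm_mul, RCLike.norm_ofReal, RCLike.norm_ofReal,
    abs_of_pos hk, abs_of_pos (div_pos hk hc')]
  field_simp

end Rearrangement

/-- The Orlicz-Lorentz space `L^{Φ,1}(ℝⁿ)`: the (a.e. classes of) measurable functions `f` with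
`‖f‖_{L^{Φ,1}} < ∞`. -/
noncomputable def orliczLorentz (n : ℕ) (𝕜 : Type*) [RCLike 𝕜] {Φ : ℝ≥0∞ → ℝ≥0∞}
    (hΦ : IsYoungFunction Φ) :
    Submodule 𝕜 (EuclideanSpace ℝ (Fin n) →ₘ[volume] 𝕜) where
  carrier := {f | orliczLorentzNorm Φ f < ∞}
  zero_mem' := by
    change orliczLorentzNorm Φ _ < ∞
    rw [orliczLorentzNorm_congr Φ (AEEqFun.coeFn_zero (μ := volume))]
    exact (orliczLorentzNorm_zero (𝕜 := 𝕜) Φ).trans_lt ENNReal.zero_lt_top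
  add_mem' := fun {f g} hf hg => by
    change orliczLorentzNorm Φ _ < ∞
    rw [orliczLorentzNorm_congr Φ (AEEqFun.coeFn_add f g)]
    exact (orliczLorentzNorm_add_le hΦ f g).trans_lt
      (ENNReal.mul_lt_top ENNReal.ofNat_lt_top (ENNReal.add_lt_top.2 ⟨hf, hg⟩))
  smul_mem' := fun c f hf => by
    change orliczLorentzNorm Φ _ < ∞
    rw [orliczLorentzNorm_congr Φ (AEEqFun.coeFn_smul c f)]
    exact (orliczLorentzNorm_const_mul_le Φ c f).trans_lt
      (ENNReal.mul_lt_top ENNReal.coe_lt_top hf)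

/-- The weak Orlicz space `wL^Φ(ℝⁿ)`: the (a.e. classes of) measurable functions `f` such that
`sup_{t>0} Φ(t) m(kf,t) < ∞` for some `k > 0`. -/
def weakOrlicz (n : ℕ) (𝕜 : Type*) [RCLike 𝕜] (Φ : ℝ≥0∞ → ℝ≥0∞) :
    Submodule 𝕜 (EuclideanSpace ℝ (Fin n) →ₘ[volume] 𝕜) where
  carrier := {f | MemWeakOrlicz Φ f}
  zero_mem' := memWeakOrlicz_congr Φ (AEEqFun.coeFn_zero (μ := volume)).symm (MemWeakOrlicz.zero Φ)
  add_mem' := fun {f g} hf hg =>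
    memWeakOrlicz_congr Φ (AEEqFun.coeFn_add f g).symm (MemWeakOrlicz.add hf hg)
  smul_mem' := fun c f hf =>
    memWeakOrlicz_congr Φ (AEEqFun.coeFn_smul c f).symm (MemWeakOrlicz.const_mul c hf)

/-- The dual space `L^{Φ,1}(ℝⁿ)*`: the linear functionals `T` on `L^{Φ,1}(ℝⁿ)` with
`|T f| ≤ C ‖f‖_{L^{Φ,1}}` for all `f`, for some finite `C`. -/
def orliczLorentzDual (n : ℕ) (𝕜 : Type*) [RCLike 𝕜] {Φ : ℝ≥0∞ → ℝ≥0∞}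
    (hΦ : IsYoungFunction Φ) : Submodule 𝕜 (orliczLorentz n 𝕜 hΦ →ₗ[𝕜] 𝕜) where
  carrier := {T | ∃ C : ℝ≥0, ∀ f : orliczLorentz n 𝕜 hΦ, ‖T f‖ₑ ≤ C * orliczLorentzNorm Φ f.1}
  zero_mem' := ⟨0, fun f => by simp⟩
  add_mem' := by
    rintro S T ⟨C, hC⟩ ⟨D, hD⟩
    refine ⟨C + D, fun f => ?_⟩
    rw [LinearMap.add_apply, ENNReal.coe_add, add_mul]
    exact (enorm_add_le _ _).trans (add_le_add (hC f) (hD f))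
  smul_mem' := by
    rintro c T ⟨C, hC⟩
    refine ⟨‖c‖₊ * C, fun f => ?_⟩
    rw [LinearMap.smul_apply, enorm_smul, ENNReal.coe_mul, mul_assoc]
    exact mul_le_mul_right (hC f) _

/-- The norm of a functional on `L^{Φ,1}(ℝⁿ)`: the infimum of all `C` with
`|T f| ≤ C ‖f‖_{L^{Φ,1}}` for all `f`. -/
noncomputable def dualNorm {n : ℕ} {𝕜 : Type*} [RCLike 𝕜] {Φ : ℝ≥0∞ → ℝ≥0∞}
    {hΦ : IsYoungFunction Φ} (T : orliczLorentz n 𝕜 hΦ →ₗ[𝕜] 𝕜) : ℝ≥0∞ :=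
  ⨅ (C : ℝ≥0) (_ : ∀ f : orliczLorentz n 𝕜 hΦ, ‖T f‖ₑ ≤ C * orliczLorentzNorm Φ f.1), (C : ℝ≥0∞)

open scoped ComplexConjugate

/-! Write `w(t) = 1 / (t Φ⁻¹(1/t))` for the weight and `W(s) = ∫₀ˢ w` for its primitive. Everything
rests on three comparisons. (a) Convexity makes `w` nonincreasing, so `W(s) ≥ 1/Φ⁻¹(1/s)`; Δ₂ gives
the converse `W(s) ≤ C/Φ⁻¹(1/s)` (`exists_lorentzPrimitive_le`). (b) The complementary function at
`b` is at least `u` when `b Φ⁻¹(u) ≥ 4u`, and at most `u` when `2b Φ⁻¹(u) ≤ u`. (c) By Tonelli, `‖f‖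
= ∫₀^∞ W(m(f,a)) da` (`orliczLorentzNorm_eq_lintegral`), which reduces estimates on `f` to estimates
on its level sets. Hölder: if `g` satisfies the weak condition with constant `l`, (b) gives `g* ≤ 4l
w`, hence `∫_A |g| ≤ 4l W(|A|)` for every `A`. The layer-cake formula for `|f|` against the measure
`|g| dx`, together with (c), yields `∫ |fg| ≤ 4l ‖f‖`. Representation: fix a strictly positive `w₀`
in `L^{Φ,1}`. The quasi-norm is order continuous, so `A ↦ T(w₀ 1_A)` is countably additive and
absolutely continuous; let `h` be its Radon–Nikodym density and `g = h/w₀`. Then `T(w₀ b) = ∫ w₀ b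
g` for bounded `b`. Testing with `w₀ b` equal to the conjugate phase of `g` on a part `E` of `{|g| >
L}` gives `L |E| ≤ ‖T‖ W(|E|)`, and (a) and (b) turn this into the weak condition
(`weak_of_enorm_integral_le`). Truncating `f` where it exceeds multiples of `w₀` extends the formula
to all `f`. -/

theorem ENNReal.exists_le_two_pow_mul {t x : ℝ≥0∞} (ht : t ≠ 0) (hx : x ≠ ∞) :
    ∃ j : ℕ, x ≤ 2 ^ j * t := by
  rcases eq_or_ne t ∞ with rfl | ht'
  · exact ⟨0, by simp⟩
  obtain ⟨j, hj⟩ := ENNReal.exists_nat_gt (ENNReal.div_ne_top hx ht)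
  refine ⟨j, ?_⟩
  rw [← ENNReal.div_le_iff ht ht']
  refine hj.le.trans ?_
  exact_mod_cast Nat.lt_two_pow_self.le

/-! ### Growth of `Φ` and of its inverse under Δ₂ -/

theorem DeltaTwo.exists_pow {Φ : ℝ≥0∞ → ℝ≥0∞} (hΔ : DeltaTwo Φ) :
    ∃ k : ℝ≥0, 1 < k ∧ ∀ (j : ℕ) (r : ℝ≥0∞), 0 < r → Φ (2 ^ j * r) ≤ k ^ j * Φ r := by
  obtain ⟨k, hk, h⟩ := hΔ
  refine ⟨k, hk, fun j => ?_⟩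
  induction j with
  | zero => simp
  | succ j ih =>
    intro r hr
    calc Φ (2 ^ (j + 1) * r) = Φ (2 * (2 ^ j * r)) := by rw [pow_succ', mul_assoc]
      _ ≤ k * Φ (2 ^ j * r) := h _ (by positivity)
      _ ≤ k * (k ^ j * Φ r) := by gcongr; exact ih r hr
      _ = _ := by rw [pow_succ', mul_assoc]

namespace IsYoungFunction

variable {Φ : ℝ≥0∞ → ℝ≥0∞}

/-- Since `b(Φ) > 0`, some `t > 0` has a finite value, and doubling propagates finiteness to every
finite `x`. -/
theorem ne_top (hΦ : IsYoungFunction Φ) (hΔ : DeltaTwo Φ) {x : ℝ≥0∞} (hx : x ≠ ∞) :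
    Φ x ≠ ∞ := by
  obtain ⟨t, ht, htb⟩ := exists_between hΦ.b_pos
  have hΦt : Φ t ≠ ∞ := fun h => (htb.trans_le (sInf_le h)).false
  obtain ⟨k, -, hk⟩ := hΔ.exists_pow
  obtain ⟨j, hj⟩ := ENNReal.exists_le_two_pow_mul ht.ne' hx
  refine ne_top_of_le_ne_top ?_ ((hΦ.monotone hj).trans (hk j t ht))
  finiteness

theorem youngB_eq_top (hΦ : IsYoungFunction Φ) (hΔ : DeltaTwo Φ) : youngB Φ = ∞ := by
  refine sInf_eq_top.2 fun t ht => ?_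
  by_contra h
  exact hΦ.ne_top hΔ h ht

/-- A zero at some `x > 0` would propagate by doubling to arbitrarily large points, against `a(Φ) <
∞`. -/
theorem map_pos (hΦ : IsYoungFunction Φ) (hΔ : DeltaTwo Φ) {x : ℝ≥0∞} (hx : 0 < x) :
    0 < Φ x := by
  by_contra h0
  have h0 : Φ x = 0 := by simpa using h0
  obtain ⟨k, -, hk⟩ := hΔ.exists_pow
  refine hΦ.a_lt_top.not_ge (le_of_forall_lt fun y hy => ?_)
  obtain ⟨z, hyz, hz⟩ := exists_between hy
  obtain ⟨j, hj⟩ := ENNReal.exists_le_two_pow_mul hx.ne' hz.ne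
  refine hyz.trans_le (hj.trans (le_sSup ?_))
  have := hk j x hx
  rw [h0, mul_zero] at this
  exact le_antisymm this zero_le

/-- Convexity between `x` and `0`, where `Φ` vanishes; convexity says nothing at `x = ∞`, so that
case is separate. -/
theorem map_mul_le (hΦ : IsYoungFunction Φ) (hΔ : DeltaTwo Φ) {θ x : ℝ≥0∞} (hθ : θ ≤ 1) :
    Φ (θ * x) ≤ θ * Φ x := by
  rcases eq_or_ne x ∞ with rfl | hx
  · rw [(hΦ.of_b_eq_top (hΦ.youngB_eq_top hΔ)).2]
    rcases eq_or_ne θ 0 with rfl | h0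
    · simp [hΦ.map_zero]
    · simp [ENNReal.mul_top h0]
  lift θ to ℝ≥0 using ne_top_of_le_ne_top ENNReal.one_ne_top hθ
  have hθ' : θ ≤ 1 := by exact_mod_cast hθ
  have hb := hΦ.youngB_eq_top hΔ
  have h := hΦ.convexOn.2 (x := x) (by simpa [hb, lt_top_iff_ne_top] using hx) (y := 0)
    hΦ.b_pos (zero_le (a := θ)) (zero_le (a := 1 - θ)) (add_tsub_cancel_of_le hθ')
  simpa [hΦ.map_zero, ENNReal.smul_def] using h

theorem mul_map_le (hΦ : IsYoungFunction Φ) (hΔ : DeltaTwo Φ) {c x : ℝ≥0∞} (hc : 1 ≤ c) :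
    c * Φ x ≤ Φ (c * x) := by
  have hc0 : c ≠ 0 := (zero_lt_one.trans_le hc).ne'
  rcases eq_or_ne c ∞ with rfl | hc'
  · rcases eq_or_ne x 0 with rfl | hx
    · simp [hΦ.map_zero]
    · rw [ENNReal.top_mul hx, (hΦ.of_b_eq_top (hΦ.youngB_eq_top hΔ)).2]
      exact le_top
  calc c * Φ x = c * Φ (c⁻¹ * (c * x)) := by
        rw [← mul_assoc, ENNReal.inv_mul_cancel hc0 hc', one_mul]
    _ ≤ c * (c⁻¹ * Φ (c * x)) := by
        gcongr
        exact hΦ.map_mul_le hΔ (ENNReal.inv_le_one.2 hc)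
    _ = Φ (c * x) := by rw [← mul_assoc, ENNReal.mul_inv_cancel hc0 hc', one_mul]

theorem lt_map_of_youngInv_lt (hΦ : IsYoungFunction Φ) {u x : ℝ≥0∞} (h : youngInv Φ u < x) :
    u < Φ x := by
  obtain ⟨y, hy, hyx⟩ := sInf_lt_iff.1 h
  exact hy.trans_le (hΦ.monotone hyx.le)

theorem le_youngInv (hΦ : IsYoungFunction Φ) {u x : ℝ≥0∞} (h : Φ x ≤ u) : x ≤ youngInv Φ u := by
  by_contra! h'
  exact (hΦ.lt_map_of_youngInv_lt h').not_ge h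

theorem youngInv_pos (hΦ : IsYoungFunction Φ) {u : ℝ≥0∞} (hu : u ≠ 0) : youngInv Φ u ≠ 0 := by
  have h := hΦ.tendsto_zero.eventually (eventually_le_nhds (pos_iff_ne_zero.2 hu))
  obtain ⟨x, hx, hx0⟩ := (h.and self_mem_nhdsWithin).exists
  exact (lt_of_lt_of_le hx0 (hΦ.le_youngInv hx)).ne'

theorem youngInv_ne_top (hΦ : IsYoungFunction Φ) (hΔ : DeltaTwo Φ) {u : ℝ≥0∞} (hu : u ≠ ∞) :
    youngInv Φ u ≠ ∞ := by
  have h1 := hΦ.map_pos hΔ zero_lt_one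
  obtain ⟨j, hj⟩ := ENNReal.exists_nat_gt
    (max_lt (ENNReal.div_lt_top hu h1.ne') ENNReal.one_lt_top).ne
  have hu' : u < Φ (j * 1) := by
    refine lt_of_lt_of_le ?_ (hΦ.mul_map_le hΔ ((le_max_right _ _).trans hj.le))
    rw [← ENNReal.div_lt_iff (Or.inl h1.ne') (Or.inl (hΦ.ne_top hΔ ENNReal.one_ne_top))]
    exact (le_max_left _ _).trans_lt hj
  exact ne_top_of_le_ne_top (by finiteness) (sInf_le hu')

/-- Multiplication by `c` sends `{Φ > u}` into `{Φ > c u}`, because `Φ(c t) ≥ c Φ(t)`. This is what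
makes the weight monotone. -/
theorem youngInv_mul_le (hΦ : IsYoungFunction Φ) (hΔ : DeltaTwo Φ) {c u : ℝ≥0∞} (hc : 1 ≤ c)
    (hc' : c ≠ ∞) : youngInv Φ (c * u) ≤ c * youngInv Φ u := by
  have hc0 : c ≠ 0 := (zero_lt_one.trans_le hc).ne'
  conv_rhs => rw [youngInv, sInf_eq_iInf]
  simp only [ENNReal.mul_iInf_of_ne hc0 hc']
  exact le_iInf₂ fun t ht =>
    sInf_le ((ENNReal.mul_lt_mul_right hc0 hc' ht).trans_le (hΦ.mul_map_le hΔ hc))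

/-- Δ₂ read on the inverse: `Φ(t) > k u` forces `Φ(t/2) > u`. This is what makes the weight
integrable at `0`. -/
theorem exists_two_mul_youngInv_le (hΦ : IsYoungFunction Φ) (hΔ : DeltaTwo Φ) :
    ∃ k : ℝ≥0, 1 < k ∧ ∀ u, 2 * youngInv Φ u ≤ youngInv Φ (k * u) := by
  obtain ⟨k, hk, h⟩ := hΔ
  refine ⟨k, hk, fun u => le_sInf fun t ht => ?_⟩
  have ht0 : 0 < t := by
    rcases eq_or_ne t 0 with rfl | h0
    · simp [hΦ.map_zero] at ht
    · exact pos_iff_ne_zero.2 h0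
  have h2 : 2 * (2⁻¹ * t) = t := by
    rw [← mul_assoc, ENNReal.mul_inv_cancel two_ne_zero ENNReal.ofNat_ne_top, one_mul]
  have hu : u < Φ (2⁻¹ * t) := by
    have := h (2⁻¹ * t) (ENNReal.mul_pos (by simp) ht0.ne')
    rw [h2] at this
    exact lt_of_mul_lt_mul_left' (lt_of_lt_of_le ht this)
  calc 2 * youngInv Φ u ≤ 2 * (2⁻¹ * t) := by gcongr; exact sInf_le hu
    _ = t := h2

end IsYoungFunction

/-! ### The complementary function compared with `Φ⁻¹` -/

section complementary

variable {Φ : ℝ≥0∞ → ℝ≥0∞}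

theorem complementaryFunction_coe (r : ℝ≥0) :
    complementaryFunction Φ r = ⨆ s : ℝ≥0, (r * s - Φ s) := by
  simp [complementaryFunction]

/-- Termwise in the supremum, since `θ Φ(s) ≤ Φ(s)`; used to absorb a finite supremum into the
scaling parameter. -/
theorem complementaryFunction_mul_le {θ : ℝ≥0∞} (hθ : θ ≤ 1) (r : ℝ≥0) :
    complementaryFunction Φ (θ * r) ≤ θ * complementaryFunction Φ r := by
  lift θ to ℝ≥0 using ne_top_of_le_ne_top ENNReal.one_ne_top hθ
  rw [← ENNReal.coe_mul, complementaryFunction_coe, complementaryFunction_coe, ENNReal.mul_iSup]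
  refine iSup_mono fun s => ?_
  rw [ENNReal.mul_sub (fun _ _ => ENNReal.coe_ne_top), ENNReal.coe_mul, mul_assoc]
  gcongr
  exact mul_le_of_le_one_left zero_le hθ

/-- Test the supremum at `s = Φ⁻¹(u)/2`: there `Φ(s) ≤ u`, while `b s ≥ 2u`. -/
theorem IsYoungFunction.le_complementaryFunction (hΦ : IsYoungFunction Φ) (hΔ : DeltaTwo Φ)
    {u b : ℝ≥0∞} (hu : u ≠ 0) (hu' : u ≠ ∞) (hb : 4 * u ≤ b * youngInv Φ u) :
    u ≤ complementaryFunction Φ b := by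
  rcases eq_or_ne b ∞ with rfl | hb'
  · simp [complementaryFunction]
  lift b to ℝ≥0 using hb'
  have hr0 := hΦ.youngInv_pos hu
  have hr := hΦ.youngInv_ne_top hΔ hu'
  lift youngInv Φ u to ℝ≥0 using hr with r hr'
  rw [complementaryFunction_coe]
  refine le_iSup_of_le (r / 2) ?_
  have hlt : ((r / 2 : ℝ≥0) : ℝ≥0∞) < youngInv Φ u := by
    rw [← hr']
    exact_mod_cast NNReal.half_lt_self (by simpa using hr0)
  have hΦr : Φ ((r / 2 : ℝ≥0) : ℝ≥0∞) ≤ u := by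
    by_contra! h
    exact hlt.not_ge (sInf_le h)
  have h2 : 2 * u ≤ b * ((r / 2 : ℝ≥0) : ℝ≥0∞) := by
    have e : (b : ℝ≥0∞) * r = 2 * (b * ((r / 2 : ℝ≥0) : ℝ≥0∞)) := by
      norm_cast
      field_simp
    rw [e, show (4 : ℝ≥0∞) = 2 * 2 by norm_num, mul_assoc] at hb
    exact (ENNReal.mul_le_mul_iff_right two_ne_zero ENNReal.ofNat_ne_top).1 hb
  calc u = 2 * u - u := by rw [two_mul, ENNReal.add_sub_cancel_right hu']
    _ ≤ _ := by gcongr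

/-- Split the supremum at `R = 2 Φ⁻¹(u)`. Below `R` the product `b x` is at most `u`; above it `Φ(x)
≥ (x/R) Φ(R) ≥ (x/R) u ≥ b x`, so the difference is not positive. -/
theorem IsYoungFunction.complementaryFunction_le (hΦ : IsYoungFunction Φ) (hΔ : DeltaTwo Φ)
    {u : ℝ≥0∞} {b : ℝ≥0} (hu : u ≠ 0) (hu' : u ≠ ∞) (hb : 2 * (b * youngInv Φ u) ≤ u) :
    complementaryFunction Φ b ≤ u := by
  rw [complementaryFunction_coe]
  refine iSup_le fun x => tsub_le_iff_right.2 ?_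
  have hr0 := hΦ.youngInv_pos hu
  have hr := hΦ.youngInv_ne_top hΔ hu'
  rcases le_total (x : ℝ≥0∞) (2 * youngInv Φ u) with hx | hx
  · calc (b : ℝ≥0∞) * x ≤ b * (2 * youngInv Φ u) := by gcongr
      _ = 2 * (b * youngInv Φ u) := by ring
      _ ≤ u := hb
      _ ≤ u + Φ x := le_self_add
  · set R := 2 * youngInv Φ u with hR
    have hR0 : R ≠ 0 := by positivity
    have hRt : R ≠ ∞ := by finiteness
    have hlt : youngInv Φ u < R := by
      rw [hR, two_mul]
      exact ENNReal.lt_add_right hr hr0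
    have hΦR : u ≤ Φ R := (hΦ.lt_map_of_youngInv_lt hlt).le
    have hxR : x / R * R = (x : ℝ≥0∞) := ENNReal.div_mul_cancel hR0 hRt
    have h1 : 1 ≤ (x : ℝ≥0∞) / R := by
      rw [ENNReal.le_div_iff_mul_le (Or.inl hR0) (Or.inl hRt)]
      simpa using hx
    calc (b : ℝ≥0∞) * x = x / R * (2 * (b * youngInv Φ u)) := by
          conv_lhs => rw [← hxR, hR]
          ring
      _ ≤ x / R * Φ R := by gcongr; exact hb.trans hΦR
      _ ≤ Φ (x / R * R) := hΦ.mul_map_le hΔ h1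
      _ = Φ x := by rw [hxR]
      _ ≤ u + Φ x := le_add_self

end complementary

/-! ### The Lorentz weight and its primitive -/

/-- The weight `Φ⁻¹(1/t)⁻¹ / t` of the Orlicz-Lorentz norm. -/
noncomputable def lorentzWeight (Φ : ℝ≥0∞ → ℝ≥0∞) (t : ℝ) : ℝ≥0∞ :=
  (youngInv Φ (1 / ENNReal.ofReal t))⁻¹ / ENNReal.ofReal t

/-- The primitive `s ↦ ∫₀ˢ Φ⁻¹(1/t)⁻¹ dt/t`. -/
noncomputable def lorentzPrimitive (Φ : ℝ≥0∞ → ℝ≥0∞) (s : ℝ≥0∞) : ℝ≥0∞ :=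
  ∫⁻ t in Ioi (0 : ℝ), {t | ENNReal.ofReal t < s}.indicator (lorentzWeight Φ) t

section weight

variable {Φ : ℝ≥0∞ → ℝ≥0∞}

theorem measurable_lorentzWeight : Measurable (lorentzWeight Φ) := by
  have h1 : Measurable (youngInv Φ) := (youngInv_mono Φ).measurable
  unfold lorentzWeight
  fun_prop

theorem lorentzWeight_eq {t : ℝ} (ht : 0 < t) :
    lorentzWeight Φ t = (youngInv Φ (1 / ENNReal.ofReal t) * ENNReal.ofReal t)⁻¹ := by
  rw [lorentzWeight, ENNReal.mul_inv (Or.inr ENNReal.ofReal_ne_top) (Or.inr (by simpa using ht)),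
    div_eq_mul_inv]

theorem lorentzWeight_mul {t : ℝ} (ht : 0 < t) :
    lorentzWeight Φ t * ENNReal.ofReal t = (youngInv Φ (1 / ENNReal.ofReal t))⁻¹ :=
  ENNReal.div_mul_cancel (by simpa using ht) ENNReal.ofReal_ne_top

theorem lorentzPrimitive_mono : Monotone (lorentzPrimitive Φ) := fun _ _ hrs =>
  lintegral_mono fun _ => indicator_le_indicator_of_subset (fun _ ht => lt_of_lt_of_le ht hrs)
    (fun _ => zero_le) _

theorem lorentzPrimitive_zero : lorentzPrimitive Φ 0 = 0 := by
  simp [lorentzPrimitive]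

theorem lorentzPrimitive_ofReal (s : ℝ) :
    lorentzPrimitive Φ (ENNReal.ofReal s) = ∫⁻ t in Ioo 0 s, lorentzWeight Φ t := by
  unfold lorentzPrimitive
  rw [setLIntegral_indicator (measurableSet_lt ENNReal.measurable_ofReal measurable_const)]
  congr 2
  ext t
  simp only [mem_inter_iff, mem_ofPred_eq, mem_Ioi, mem_Ioo]
  constructor
  · rintro ⟨h1, h2⟩
    exact ⟨h2, (ENNReal.ofReal_lt_ofReal_iff_of_nonneg h2.le).1 h1⟩
  · rintro ⟨h1, h2⟩
    exact ⟨(ENNReal.ofReal_lt_ofReal_iff_of_nonneg h1.le).2 h2, h1⟩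

namespace IsYoungFunction

theorem lorentzWeight_ne_top (hΦ : IsYoungFunction Φ) {t : ℝ} (ht : 0 < t) :
    lorentzWeight Φ t ≠ ∞ := by
  rw [lorentzWeight_eq ht, ENNReal.inv_ne_top]
  refine mul_ne_zero (hΦ.youngInv_pos ?_) (by simpa using ht)
  simp

/-- The reciprocal `t Φ⁻¹(1/t)` is nondecreasing: apply `youngInv_mul_le` with factor `t/s`. -/
theorem lorentzWeight_anti (hΦ : IsYoungFunction Φ) (hΔ : DeltaTwo Φ) {s t : ℝ} (hs : 0 < s)
    (hst : s ≤ t) : lorentzWeight Φ t ≤ lorentzWeight Φ s := by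
  have ht : 0 < t := hs.trans_le hst
  rw [lorentzWeight_eq ht, lorentzWeight_eq hs, ENNReal.inv_le_inv]
  have hS : ENNReal.ofReal s ≠ 0 := by simpa using hs
  have hT : ENNReal.ofReal t ≠ 0 := by simpa using ht
  have hST : ENNReal.ofReal s ≤ ENNReal.ofReal t := ENNReal.ofReal_le_ofReal hst
  have hS' : ENNReal.ofReal s ≠ ∞ := ENNReal.ofReal_ne_top
  have hT' : ENNReal.ofReal t ≠ ∞ := ENNReal.ofReal_ne_top
  generalize ENNReal.ofReal s = S at *
  generalize ENNReal.ofReal t = T at *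
  have h := hΦ.youngInv_mul_le hΔ (c := T / S) (u := 1 / T)
    ((ENNReal.le_div_iff_mul_le (Or.inl hS) (Or.inl hS')).2 (by simpa using hST))
    (ENNReal.div_ne_top hT' hS)
  have e : T / S * (1 / T) = 1 / S := by
    rw [div_eq_mul_inv, one_div, one_div, mul_right_comm, ENNReal.mul_inv_cancel hT hT', one_mul]
  rw [e] at h
  calc youngInv Φ (1 / S) * S ≤ T / S * youngInv Φ (1 / T) * S := by gcongr
    _ = T / S * S * youngInv Φ (1 / T) := by ring
    _ = _ := by rw [ENNReal.div_mul_cancel hS hS', mul_comm]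

theorem inv_youngInv_le_lorentzPrimitive (hΦ : IsYoungFunction Φ) (hΔ : DeltaTwo Φ) {s : ℝ}
    (hs : 0 < s) :
    (youngInv Φ (1 / ENNReal.ofReal s))⁻¹ ≤ lorentzPrimitive Φ (ENNReal.ofReal s) := by
  rw [lorentzPrimitive_ofReal, ← lorentzWeight_mul hs]
  calc lorentzWeight Φ s * ENNReal.ofReal s = ∫⁻ _ in Ioo 0 s, lorentzWeight Φ s := by
        simp
    _ ≤ _ := setLIntegral_mono' measurableSet_Ioo fun t ht => hΦ.lorentzWeight_anti hΔ ht.1 ht.2.le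

/-- As `Φ(ε) > 0` for every `ε > 0`, `Φ⁻¹(1/j) ≤ ε` for large `j`, so the lower bound for the
primitive is unbounded. -/
theorem lorentzPrimitive_top (hΦ : IsYoungFunction Φ) (hΔ : DeltaTwo Φ) :
    lorentzPrimitive Φ ∞ = ∞ := by
  refine ENNReal.eq_top_of_forall_nnreal_le fun r => ?_
  set ε : ℝ≥0∞ := (max r 1 : ℝ≥0)⁻¹ with hε
  have hε0 : 0 < ε := by
    rw [hε, ENNReal.inv_pos]
    exact ENNReal.coe_ne_top
  have hΦε := hΦ.map_pos hΔ hε0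
  obtain ⟨j, hj⟩ := ENNReal.exists_nat_gt (ENNReal.inv_ne_top.2 hΦε.ne')
  have hj0 : (0 : ℝ) < j := by
    rcases Nat.eq_zero_or_pos j with rfl | h
    · simp at hj
    · exact_mod_cast h
  have h1 : youngInv Φ (1 / ENNReal.ofReal j) ≤ ε := by
    refine sInf_le ?_
    change 1 / ENNReal.ofReal j < Φ ε
    rw [ENNReal.ofReal_natCast, one_div]
    exact ENNReal.inv_lt_iff_inv_lt.1 hj
  calc (r : ℝ≥0∞) ≤ (max r 1 : ℝ≥0) := by exact_mod_cast le_max_left _ _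
    _ = ε⁻¹ := by rw [hε, inv_inv]
    _ ≤ (youngInv Φ (1 / ENNReal.ofReal j))⁻¹ := ENNReal.inv_le_inv.2 h1
    _ ≤ lorentzPrimitive Φ (ENNReal.ofReal j) := hΦ.inv_youngInv_le_lorentzPrimitive hΔ hj0
    _ ≤ _ := lorentzPrimitive_mono le_top

/-- Absorption: with `A` the integral on the left, dilation by `k` gives `2A ≤ A + k/Φ⁻¹(1/s)`. The
cutoff `ε` makes `A` finite, so one `A` can be cancelled, and the bound does not depend on `ε`. -/
theorem setLIntegral_lorentzWeight_le (hΦ : IsYoungFunction Φ) (hΔ : DeltaTwo Φ) {k : ℝ≥0}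
    (hk : 1 < k) (h : ∀ u, 2 * youngInv Φ u ≤ youngInv Φ (k * u)) {ε s : ℝ} (hε : 0 < ε)
    (hs : 0 < s) :
    ∫⁻ t in Ioo ε s, lorentzWeight Φ t ≤ k * (youngInv Φ (1 / ENNReal.ofReal s))⁻¹ := by
  have hk0 : (0 : ℝ) < k := by exact_mod_cast zero_lt_one.trans hk
  have hkE : ENNReal.ofReal (k : ℝ) = k := ENNReal.ofReal_coe_nnreal
  have hkE0 : (k : ℝ≥0∞) ≠ 0 := by exact_mod_cast (zero_lt_one.trans hk).ne'
  -- the weight gains a factor `1/2` over `1/t` under dilation by `k`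
  have hw : ∀ t : ℝ, 0 < t → 2 * lorentzWeight Φ t ≤ k * lorentzWeight Φ (k * t) := by
    intro t ht
    have hT : ENNReal.ofReal t ≠ 0 := by simpa using ht
    have hT' : ENNReal.ofReal t ≠ ∞ := ENNReal.ofReal_ne_top
    unfold lorentzWeight
    rw [ENNReal.ofReal_mul hk0.le, hkE]
    generalize ENNReal.ofReal t = T at *
    have h1 := h (1 / (k * T))
    have e : (k : ℝ≥0∞) * (1 / (k * T)) = 1 / T := by
      rw [one_div, one_div, ENNReal.mul_inv (Or.inl hkE0) (Or.inl ENNReal.coe_ne_top), ← mul_assoc,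
        ENNReal.mul_inv_cancel hkE0 ENNReal.coe_ne_top, one_mul]
    rw [e] at h1
    have h2 := ENNReal.inv_le_inv.2 h1
    rw [ENNReal.mul_inv (by simp) (by simp)] at h2
    generalize (youngInv Φ (1 / (k * T)))⁻¹ = Y at *
    calc 2 * ((youngInv Φ (1 / T))⁻¹ / T) ≤ 2 * ((2⁻¹ * Y) / T) := by gcongr
      _ = (2 * 2⁻¹) * (k * (k : ℝ≥0∞)⁻¹) * (Y * T⁻¹) := by
        rw [ENNReal.mul_inv_cancel hkE0 ENNReal.coe_ne_top, div_eq_mul_inv]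
        ring
      _ = k * (Y / (k * T)) := by
        rw [ENNReal.mul_inv_cancel (by simp) (by simp), div_eq_mul_inv,
          ENNReal.mul_inv (Or.inl hkE0) (Or.inl ENNReal.coe_ne_top)]
        ring
  set A := ∫⁻ t in Ioo ε s, lorentzWeight Φ t with hA
  have hAtop : A ≠ ∞ := by
    refine ne_top_of_le_ne_top ?_ (setLIntegral_mono' (g := fun _ => lorentzWeight Φ ε)
      measurableSet_Ioo fun t ht => hΦ.lorentzWeight_anti hΔ hε ht.1.le)
    have := hΦ.lorentzWeight_ne_top hε
    simp only [lintegral_const, MeasurableSet.univ, Measure.restrict_apply, univ_inter,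
      Real.volume_Ioo]
    finiteness
  -- The substitution `t ↦ k t` maps `(ε, s/k)` into `(ε, s)`, and its Jacobian cancels the factor
  -- `k` of `hw`.
  have h1 : 2 * ∫⁻ t in Ioo ε (s / k), lorentzWeight Φ t ≤ A := by
    have hm := measurable_lorentzWeight (Φ := Φ)
    calc 2 * ∫⁻ t in Ioo ε (s / k), lorentzWeight Φ t
        = ∫⁻ t in Ioo ε (s / k), 2 * lorentzWeight Φ t := (lintegral_const_mul _ hm).symm
      _ ≤ ∫⁻ t in Ioo ε (s / k), k * (Ioo ε s).indicator (lorentzWeight Φ) (k * t) := by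
        refine setLIntegral_mono' measurableSet_Ioo fun t ht => ?_
        rw [indicator_of_mem]
        · exact hw t (hε.trans ht.1)
        · refine ⟨ht.1.trans ?_, ?_⟩
          · exact lt_mul_of_one_lt_left (hε.trans ht.1) (by exact_mod_cast hk)
          · have := (lt_div_iff₀ hk0).1 ht.2
            linarith
      _ ≤ ∫⁻ t, k * (Ioo ε s).indicator (lorentzWeight Φ) (k * t) := setLIntegral_le_lintegral _ _
      _ = k * ∫⁻ t, (Ioo ε s).indicator (lorentzWeight Φ) (k * t) :=
        lintegral_const_mul _ ((hm.indicator measurableSet_Ioo).comp (measurable_const_mul _))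
      _ = A := by
        rw [← lintegral_map (g := fun t : ℝ => (k : ℝ) * t)
          (hm.indicator measurableSet_Ioo) (by fun_prop),
          Real.map_volume_mul_left hk0.ne', lintegral_smul_measure,
          lintegral_indicator measurableSet_Ioo, abs_of_pos (inv_pos.2 hk0),
          ENNReal.ofReal_inv_of_pos hk0, hkE, smul_eq_mul, ← mul_assoc,
          ENNReal.mul_inv_cancel hkE0 ENNReal.coe_ne_top, one_mul]
  -- On the last piece the weight is at most its value at `s/k`, which `hw` compares with its value
  -- at `s`; the length is at most `s`.
  have h2 : 2 * ∫⁻ t in Ico (s / k) s, lorentzWeight Φ t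
      ≤ k * (youngInv Φ (1 / ENNReal.ofReal s))⁻¹ := by
    have hsk : 0 < s / k := div_pos hs hk0
    have e : (k : ℝ) * (s / k) = s := by field_simp
    calc 2 * ∫⁻ t in Ico (s / k) s, lorentzWeight Φ t
        ≤ 2 * ∫⁻ _ in Ico (s / k) s, lorentzWeight Φ (s / k) := by
          gcongr 2 * ?_
          exact setLIntegral_mono' measurableSet_Ico fun t ht => hΦ.lorentzWeight_anti hΔ hsk ht.1
      _ ≤ 2 * (lorentzWeight Φ (s / k) * ENNReal.ofReal s) := by
          simp only [lintegral_const, MeasurableSet.univ, Measure.restrict_apply, univ_inter,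
            Real.volume_Ico]
          gcongr
          linarith
      _ = 2 * lorentzWeight Φ (s / k) * ENNReal.ofReal s := by ring
      _ ≤ k * lorentzWeight Φ s * ENNReal.ofReal s := by
          have := hw _ hsk
          rw [e] at this
          gcongr ?_ * _
      _ = _ := by rw [mul_assoc, lorentzWeight_mul hs]
  have h3 : A ≤ (∫⁻ t in Ioo ε (s / k), lorentzWeight Φ t)
      + ∫⁻ t in Ico (s / k) s, lorentzWeight Φ t := by
    refine (lintegral_mono_set fun t ht => ?_).trans (lintegral_union_le _ _ _)
    rcases lt_or_ge t (s / k) with h | h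
    · exact Or.inl ⟨ht.1, h⟩
    · exact Or.inr ⟨h, ht.2⟩
  have h4 : A + A ≤ A + k * (youngInv Φ (1 / ENNReal.ofReal s))⁻¹ := by
    calc A + A = 2 * A := (two_mul A).symm
      _ ≤ 2 * _ := by gcongr 2 * ?_
      _ ≤ _ := by rw [mul_add]; exact add_le_add h1 h2
  exact (ENNReal.add_le_add_iff_left hAtop).1 h4

/-- The cutoff bound passes to the limit along `ε = 1/(j+1)`; `C` is the doubling constant. -/
theorem exists_lorentzPrimitive_le (hΦ : IsYoungFunction Φ) (hΔ : DeltaTwo Φ) :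
    ∃ C : ℝ≥0, 0 < C ∧ ∀ s : ℝ≥0∞, s ≠ 0 → s ≠ ∞ →
      lorentzPrimitive Φ s ≤ C * (youngInv Φ (1 / s))⁻¹ := by
  obtain ⟨k, hk, h⟩ := hΦ.exists_two_mul_youngInv_le hΔ
  refine ⟨k, zero_lt_one.trans hk, fun s hs0 hs => ?_⟩
  obtain ⟨s, rfl⟩ : ∃ r : ℝ, s = ENNReal.ofReal r := ⟨s.toReal, (ENNReal.ofReal_toReal hs).symm⟩
  have hs0 : 0 < s := by simpa using hs0
  have hU : Ioo 0 s = ⋃ j : ℕ, Ioo (1 / ((j : ℝ) + 1)) s := by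
    ext t
    simp only [mem_Ioo, mem_iUnion]
    constructor
    · rintro ⟨h0, h1⟩
      obtain ⟨j, hj⟩ := exists_nat_one_div_lt h0
      exact ⟨j, hj, h1⟩
    · rintro ⟨j, h0, h1⟩
      exact ⟨lt_trans (by positivity) h0, h1⟩
  rw [lorentzPrimitive_ofReal, hU, setLIntegral_iUnion_of_directed]
  · exact iSup_le fun j => hΦ.setLIntegral_lorentzWeight_le hΔ hk h (by positivity) hs0
  · refine Monotone.directed_le fun i j hij => Ioo_subset_Ioo_left ?_
    exact Nat.one_div_le_one_div hij

theorem lorentzPrimitive_ne_top (hΦ : IsYoungFunction Φ) (hΔ : DeltaTwo Φ) {s : ℝ≥0∞}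
    (hs : s ≠ ∞) : lorentzPrimitive Φ s ≠ ∞ := by
  rcases eq_or_ne s 0 with rfl | h0
  · simp [lorentzPrimitive_zero]
  obtain ⟨C, -, hC⟩ := hΦ.exists_lorentzPrimitive_le hΔ
  refine ne_top_of_le_ne_top (ENNReal.mul_ne_top ENNReal.coe_ne_top ?_) (hC s h0 hs)
  exact ENNReal.inv_ne_top.2 (hΦ.youngInv_pos (by simpa using hs))

/-- Finiteness of `Φ` enters here: `Φ⁻¹(1/s) ≥ C/ε` once `1/s ≥ Φ(C/ε)`. -/
theorem tendsto_lorentzPrimitive_zero (hΦ : IsYoungFunction Φ) (hΔ : DeltaTwo Φ) :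
    Tendsto (lorentzPrimitive Φ) (𝓝 0) (𝓝 0) := by
  obtain ⟨C, hC0, hC⟩ := hΦ.exists_lorentzPrimitive_le hΔ
  rw [ENNReal.tendsto_nhds_zero]
  intro ε hε
  have hX : (C : ℝ≥0∞) / ε ≠ ∞ := ENNReal.div_ne_top ENNReal.coe_ne_top hε.ne'
  have hδ : 0 < (Φ (C / ε))⁻¹ := ENNReal.inv_pos.2 (hΦ.ne_top hΔ hX)
  filter_upwards [eventually_lt_nhds hδ, eventually_lt_nhds ENNReal.zero_lt_top] with s hs hs'
  rcases eq_or_ne s 0 with rfl | h0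
  · simp [lorentzPrimitive_zero]
  refine (hC s h0 hs'.ne).trans ?_
  have h1 : C / ε ≤ youngInv Φ (1 / s) := by
    refine hΦ.le_youngInv ?_
    rw [one_div]
    exact (ENNReal.le_inv_iff_le_inv.1 hs.le)
  rcases eq_or_ne ε ∞ with rfl | hε'
  · exact le_top
  calc (C : ℝ≥0∞) * (youngInv Φ (1 / s))⁻¹ ≤ C * (C / ε)⁻¹ := by gcongr
    _ = C * (C : ℝ≥0∞)⁻¹ * ε := by
      rw [div_eq_mul_inv, ENNReal.mul_inv (Or.inr (by simpa using hε.ne'))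
        (Or.inl ENNReal.coe_ne_top), inv_inv, mul_assoc]
    _ = ε := by
      rw [ENNReal.mul_inv_cancel (by exact_mod_cast hC0.ne') ENNReal.coe_ne_top, one_mul]

end IsYoungFunction

end weight

/-! ### Layer-cake formulas and order continuity -/

theorem volume_ofReal_lt (s : ℝ≥0∞) :
    ∫⁻ t in Ioi (0 : ℝ), {t | ENNReal.ofReal t < s}.indicator 1 t = s := by
  rw [setLIntegral_indicator (measurableSet_lt ENNReal.measurable_ofReal measurable_const)]
  simp only [Pi.one_apply, lintegral_const, one_mul, Measure.restrict_apply MeasurableSet.univ,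
    univ_inter]
  rcases eq_or_ne s ∞ with rfl | hs
  · simp
  have : {t | ENNReal.ofReal t < s} ∩ Ioi 0 = Ioo 0 s.toReal := by
    ext t
    simp only [mem_inter_iff, mem_ofPred_eq, mem_Ioi, mem_Ioo]
    constructor
    · rintro ⟨h1, h2⟩
      exact ⟨h2, (ENNReal.ofReal_lt_iff_lt_toReal h2.le hs).1 h1⟩
    · rintro ⟨h1, h2⟩
      exact ⟨(ENNReal.ofReal_lt_iff_lt_toReal h1.le hs).2 h2, h1⟩
  rw [this, Real.volume_Ioo, sub_zero, ENNReal.ofReal_toReal hs]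

section

variable {n : ℕ} {𝕜 : Type*} [RCLike 𝕜] {Φ : ℝ≥0∞ → ℝ≥0∞}

theorem distribFun_antitone (f : EuclideanSpace ℝ (Fin n) → 𝕜) : Antitone (distribFun f) :=
  fun _ _ hst => measure_mono fun _ hx => lt_of_le_of_lt hst hx

theorem measurable_distribFun_toNNReal (f : EuclideanSpace ℝ (Fin n) → 𝕜) :
    Measurable fun a : ℝ => distribFun f a.toNNReal :=
  ((distribFun_antitone f).comp_monotone fun _ _ h => Real.toNNReal_mono h).measurable

theorem distribFun_toNNReal (f : EuclideanSpace ℝ (Fin n) → 𝕜) {a : ℝ} (ha : 0 < a) :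
    distribFun f a.toNNReal = volume {x | a < ‖f x‖} := by
  unfold distribFun
  congr 1
  ext x
  simp [← NNReal.coe_lt_coe, ha.le]

/-- The distribution function is nonincreasing, so `{a > 0 : t < m(f,a)}` is an interval starting at
`0`, and its length is `f*(t)`. -/
theorem rearrangement_eq_lintegral (f : EuclideanSpace ℝ (Fin n) → 𝕜) (t : ℝ≥0∞) :
    rearrangement f t
      = ∫⁻ a in Ioi (0 : ℝ), {a : ℝ | t < distribFun f a.toNNReal}.indicator 1 a := by
  rw [setLIntegral_indicator (measurableSet_lt measurable_const (measurable_distribFun_toNNReal f))]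
  simp only [Pi.one_apply, lintegral_const, one_mul, Measure.restrict_apply MeasurableSet.univ,
    univ_inter]
  apply le_antisymm
  · refine le_of_forall_lt fun c hc => ?_
    obtain ⟨d, hcd, hd⟩ := ENNReal.lt_iff_exists_nnreal_btwn.1 hc
    refine hcd.trans_le ?_
    rw [show (d : ℝ≥0∞) = volume (Ioo (0 : ℝ) d) by simp]
    refine measure_mono fun a ha => ⟨?_, ha.1⟩
    by_contra h
    simp only [mem_ofPred_eq, not_lt] at h
    have h1 : rearrangement f t ≤ a.toNNReal := iInf₂_le a.toNNReal ⟨by simpa using ha.1, h⟩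
    have h2 : (a.toNNReal : ℝ≥0∞) < d := by
      rw [ENNReal.coe_lt_coe, Real.toNNReal_lt_iff_lt_coe ha.1.le]
      exact ha.2
    exact (hd.trans_le h1).not_gt h2
  · refine le_iInf₂ fun α hα => ?_
    calc _ ≤ volume (Ioo (0 : ℝ) α) := measure_mono fun a ha => ⟨ha.2, ?_⟩
      _ = α := by simp
    by_contra! h
    have : distribFun f a.toNNReal ≤ distribFun f α :=
      distribFun_antitone f (by rw [← NNReal.coe_le_coe]; exact h.trans (Real.le_coe_toNNReal a))
    exact (lt_of_lt_of_le ha.1 (this.trans hα.2)).false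

theorem lintegral_swap_distribFun (f : EuclideanSpace ℝ (Fin n) → 𝕜) {w : ℝ → ℝ≥0∞}
    (hw : Measurable w) :
    ∫⁻ t in Ioi (0 : ℝ), w t * rearrangement f (ENNReal.ofReal t)
      = ∫⁻ a in Ioi (0 : ℝ), ∫⁻ t in Ioi (0 : ℝ),
        {t | ENNReal.ofReal t < distribFun f a.toNNReal}.indicator w t := by
  have hd := measurable_distribFun_toNNReal f
  rw [lintegral_lintegral_swap]
  · refine lintegral_congr fun t => ?_
    rw [rearrangement_eq_lintegral, ← lintegral_const_mul _
      (measurable_one.indicator (measurableSet_lt measurable_const hd))]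
    refine lintegral_congr fun a => ?_
    by_cases h : ENNReal.ofReal t < distribFun f a.toNNReal <;> simp [indicator, h]
  · have : Measurable ({p : ℝ × ℝ | ENNReal.ofReal p.2 < distribFun f p.1.toNNReal}.indicator
        fun p => w p.2) := by
      refine (hw.comp measurable_snd).indicator (measurableSet_lt ?_ (hd.comp measurable_fst))
      exact ENNReal.measurable_ofReal.comp measurable_snd
    exact this.aemeasurable

/-- Tonelli on the region `t < m(f,a)`. In this form the norm is visibly monotone in `|f|` and open
to dominated convergence. -/
theorem orliczLorentzNorm_eq_lintegral (f : EuclideanSpace ℝ (Fin n) → 𝕜) :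
    orliczLorentzNorm Φ f
      = ∫⁻ a in Ioi (0 : ℝ), lorentzPrimitive Φ (distribFun f a.toNNReal) := by
  have h := lintegral_swap_distribFun f (measurable_lorentzWeight (Φ := Φ))
  unfold lorentzPrimitive
  rw [← h, orliczLorentzNorm]
  refine lintegral_congr fun t => ?_
  rw [lorentzWeight, ENNReal.mul_comm_div, mul_div_assoc]

theorem orliczLorentzNorm_mono {f g : EuclideanSpace ℝ (Fin n) → 𝕜} (h : ∀ x, ‖f x‖ ≤ ‖g x‖) :
    orliczLorentzNorm Φ f ≤ orliczLorentzNorm Φ g := by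
  rw [orliczLorentzNorm_eq_lintegral, orliczLorentzNorm_eq_lintegral]
  exact lintegral_mono fun a => lorentzPrimitive_mono (distribFun_mono h _)

/-- An infinite level set at height `a` makes all lower ones infinite, and the primitive at `∞` is
`∞`. -/
theorem distribFun_ne_top_of_orliczLorentzNorm (hΦ : IsYoungFunction Φ) (hΔ : DeltaTwo Φ)
    {f : EuclideanSpace ℝ (Fin n) → 𝕜} (hf : orliczLorentzNorm Φ f ≠ ∞) {a : ℝ} (ha : 0 < a) :
    distribFun f a.toNNReal ≠ ∞ := by
  intro h
  apply hf
  rw [orliczLorentzNorm_eq_lintegral, eq_top_iff]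
  calc ∞ = ∫⁻ _ in Ioo 0 a, ∞ := by simp [ENNReal.top_mul, ha]
    _ ≤ ∫⁻ b in Ioo 0 a, lorentzPrimitive Φ (distribFun f b.toNNReal) := by
      refine setLIntegral_mono' measurableSet_Ioo fun b hb => ?_
      have h1 : distribFun f a.toNNReal ≤ distribFun f b.toNNReal :=
        distribFun_antitone f (Real.toNNReal_mono hb.2.le)
      rw [h, top_le_iff] at h1
      rw [h1,
        hΦ.lorentzPrimitive_top hΔ]
    _ ≤ _ := lintegral_mono_set fun b hb => hb.1

/-- Order continuity of the Orlicz-Lorentz quasi-norm. -/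
theorem tendsto_orliczLorentzNorm_zero (hΦ : IsYoungFunction Φ) (hΔ : DeltaTwo Φ)
    {ι : Type*} {l : Filter ι} [l.IsCountablyGenerated] {F : EuclideanSpace ℝ (Fin n) → 𝕜}
    {u : ι → EuclideanSpace ℝ (Fin n) → 𝕜}
    (hF : Measurable F) (hu : ∀ j, Measurable (u j)) (hFn : orliczLorentzNorm Φ F ≠ ∞)
    (hle : ∀ j x, ‖u j x‖ ≤ ‖F x‖) (hlim : ∀ x, Tendsto (fun j => u j x) l (𝓝 0)) :
    Tendsto (fun j => orliczLorentzNorm Φ (u j)) l (𝓝 0) := by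
  simp only [orliczLorentzNorm_eq_lintegral] at hFn ⊢
  -- Dominated convergence is used twice: here at a fixed height, with the level set of `F` (of
  -- finite measure) as bound, and then over all heights.
  have key : ∀ a : ℝ, 0 < a →
      Tendsto (fun j => lorentzPrimitive Φ (distribFun (u j) a.toNNReal)) l (𝓝 0) := by
    intro a ha
    refine (hΦ.tendsto_lorentzPrimitive_zero hΔ).comp ?_
    have hfin := distribFun_ne_top_of_orliczLorentzNorm hΦ hΔ
      (by rwa [orliczLorentzNorm_eq_lintegral]) ha (f := F)
    have hmeas : ∀ {v : EuclideanSpace ℝ (Fin n) → 𝕜}, Measurable v →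
        MeasurableSet {x | a.toNNReal < ‖v x‖₊} := fun hv => measurableSet_lt measurable_const
          hv.nnnorm
    have e : ∀ {v : EuclideanSpace ℝ (Fin n) → 𝕜}, Measurable v → distribFun v a.toNNReal
        = ∫⁻ x, {x | a.toNNReal < ‖v x‖₊}.indicator 1 x := fun hv =>
      (lintegral_indicator_one (hmeas hv)).symm
    rw [e hF] at hfin
    simp only [e (hu _)]
    rw [← lintegral_zero (μ := (volume : Measure (EuclideanSpace ℝ (Fin n))))]
    refine tendsto_lintegral_filter_of_dominated_convergence _
      (Eventually.of_forall fun j => measurable_one.indicator (hmeas (hu j)))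
      (Eventually.of_forall fun j => Eventually.of_forall fun x => indicator_le_indicator_of_subset
        (fun y hy => lt_of_lt_of_le hy (hle j y)) (fun _ => zero_le) x) hfin
      (Eventually.of_forall fun x => ?_)
    refine tendsto_const_nhds.congr' ?_
    have h0 : Tendsto (fun j => ‖u j x‖₊) l (𝓝 0) := by
      simpa using (hlim x).nnnorm
    filter_upwards [h0.eventually (eventually_lt_nhds (Real.toNNReal_pos.2 ha))] with j hj
    rw [indicator_of_notMem]
    exact fun h => lt_asymm hj h
  rw [← lintegral_zero (μ := volume.restrict (Ioi (0 : ℝ)))]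
  refine tendsto_lintegral_filter_of_dominated_convergence _
    (Eventually.of_forall fun j =>
      lorentzPrimitive_mono.measurable.comp (measurable_distribFun_toNNReal _))
    (Eventually.of_forall fun j => Eventually.of_forall fun a =>
      lorentzPrimitive_mono (distribFun_mono (hle j) _)) hFn ?_
  exact (ae_restrict_iff' measurableSet_Ioi).2 (Eventually.of_forall key)

theorem lorentzPrimitive_le_add (hΦ : IsYoungFunction Φ) (hΔ : DeltaTwo Φ) (s : ℝ≥0∞) :
    lorentzPrimitive Φ s ≤ lorentzPrimitive Φ 1 + lorentzWeight Φ 1 * s := by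
  have hms : ∀ s, MeasurableSet {t | ENNReal.ofReal t < s} := fun s =>
    measurableSet_lt ENNReal.measurable_ofReal measurable_const
  conv_rhs => rw [← volume_ofReal_lt s]
  unfold lorentzPrimitive
  rw [← lintegral_const_mul _ (measurable_one.indicator (hms s)),
    ← lintegral_add_left (measurable_lorentzWeight.indicator (hms 1))]
  refine setLIntegral_mono' measurableSet_Ioi fun t ht => ?_
  by_cases h : ENNReal.ofReal t < s
  · simp only [indicator, mem_ofPred_eq, h, if_true, Pi.one_apply, mul_one]
    by_cases h1 : ENNReal.ofReal t < 1
    · rw [if_pos h1]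
      exact le_self_add
    · exact le_add_left (hΦ.lorentzWeight_anti hΔ one_pos (by simpa using h1))
  · simp [indicator, h]

variable (n 𝕜) in
-- Take `min(g, 1)` with `g > 0` integrable. The primitive grows at most affinely, its constant term
-- counts only for heights below `1`, and the linear term integrates to a multiple of `∫ min(g, 1)`.
-- Such a function plays the role of a σ-finite exhaustion.
theorem exists_pos_orliczLorentzNorm_ne_top (hΦ : IsYoungFunction Φ) (hΔ : DeltaTwo Φ) :
    ∃ w : EuclideanSpace ℝ (Fin n) → ℝ, Measurable w ∧ (∀ x, 0 < w x) ∧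
      orliczLorentzNorm Φ (fun x => (w x : 𝕜)) ≠ ∞ := by
  obtain ⟨g, hg0, hgm, hg⟩ := exists_pos_lintegral_lt_of_sigmaFinite
    (volume : Measure (EuclideanSpace ℝ (Fin n))) one_ne_zero
  have hm : Measurable fun x => ((min (g x) 1 : ℝ≥0) : ℝ) := by fun_prop
  refine ⟨fun x => (min (g x) 1 : ℝ≥0), hm, fun x => by simpa using hg0 x, ?_⟩
  set W : EuclideanSpace ℝ (Fin n) → 𝕜 := fun x => (((min (g x) 1 : ℝ≥0) : ℝ) : 𝕜) with hW
  have hWn : ∀ x, ‖W x‖ = (min (g x) 1 : ℝ≥0) := fun x => by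
    rw [hW, RCLike.norm_ofReal, abs_of_nonneg (NNReal.coe_nonneg _)]
  have hint : ∫⁻ a in Ioi (0 : ℝ), distribFun W a.toNNReal ≤ 1 := by
    calc ∫⁻ a in Ioi (0 : ℝ), distribFun W a.toNNReal
        = ∫⁻ a in Ioi (0 : ℝ), volume {x | a < ((min (g x) 1 : ℝ≥0) : ℝ)} :=
          setLIntegral_congr_fun measurableSet_Ioi fun a ha => by
            simp only [distribFun_toNNReal W ha, hWn]
      _ = ∫⁻ x, ENNReal.ofReal (min (g x) 1 : ℝ≥0) :=
          (lintegral_eq_lintegral_meas_lt _ (Eventually.of_forall fun x => NNReal.coe_nonneg _)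
            hm.aemeasurable).symm
      _ ≤ ∫⁻ x, g x := lintegral_mono fun x => by
          rw [ENNReal.ofReal_coe_nnreal]
          exact ENNReal.coe_le_coe.2 (min_le_left _ _)
      _ ≤ 1 := hg.le
  rw [orliczLorentzNorm_eq_lintegral]
  have h1 : ∫⁻ a in Ioi (0 : ℝ), lorentzPrimitive Φ (distribFun W a.toNNReal)
      ≤ ∫⁻ a in Ioi (0 : ℝ), ((Ioo (0 : ℝ) 1).indicator (fun _ => lorentzPrimitive Φ 1) a
        + lorentzWeight Φ 1 * distribFun W a.toNNReal) := by
    refine setLIntegral_mono' measurableSet_Ioi fun a ha => ?_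
    rcases lt_or_ge a 1 with h | h
    · rw [indicator_of_mem (show a ∈ Ioo (0 : ℝ) 1 from ⟨ha, h⟩)]
      exact lorentzPrimitive_le_add hΦ hΔ _
    · have : distribFun W a.toNNReal = 0 := by
        rw [distribFun_toNNReal W ha]
        have : {x | a < ‖W x‖} = ∅ := by
          ext x
          simp only [hWn, mem_ofPred_eq, mem_empty_iff_false, iff_false, not_lt]
          refine le_trans ?_ h
          exact_mod_cast min_le_right _ _
        rw [this, measure_empty]
      rw [this, lorentzPrimitive_zero]
      exact zero_le
  refine ne_top_of_le_ne_top ?_ h1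
  rw [lintegral_add_left (measurable_const.indicator measurableSet_Ioo),
    lintegral_const_mul _ (measurable_distribFun_toNNReal W)]
  refine ENNReal.add_ne_top.2 ⟨?_, ENNReal.mul_ne_top (hΦ.lorentzWeight_ne_top one_pos)
    (ne_top_of_le_ne_top ENNReal.one_ne_top hint)⟩
  rw [setLIntegral_indicator measurableSet_Ioo]
  have := hΦ.lorentzPrimitive_ne_top hΔ ENNReal.one_ne_top
  have h2 : volume (Ioo (0 : ℝ) 1 ∩ Ioi 0) ≠ ∞ :=
    ne_top_of_le_ne_top (by simp) (measure_mono inter_subset_left)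
  simp only [lintegral_const, Measure.restrict_apply MeasurableSet.univ, univ_inter]
  exact ENNReal.mul_ne_top this h2

/-! ### From the weak condition to Hölder's inequality -/

/-- With `u = 1/t`, the choice `b = 4 w(t)` gives exactly `b Φ⁻¹(u) = 4u`; so the complementary
function at `b` is at least `1/t`, and the weak condition yields `m(g, l b) ≤ t`. -/
theorem rearrangement_le_of_weak (hΦ : IsYoungFunction Φ) (hΔ : DeltaTwo Φ)
    {g : EuclideanSpace ℝ (Fin n) → 𝕜} {l : ℝ≥0} (hl : 0 < l)
    (hg : ∀ t : ℝ≥0, 0 < t → complementaryFunction Φ t * distribFun g (l * t) ≤ 1) {t : ℝ}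
    (ht : 0 < t) : rearrangement g (ENNReal.ofReal t) ≤ 4 * l * lorentzWeight Φ t := by
  have hT : ENNReal.ofReal t ≠ 0 := by simpa using ht
  have hu0 : 1 / ENNReal.ofReal t ≠ 0 := by simp
  have hut : 1 / ENNReal.ofReal t ≠ ∞ := ENNReal.div_ne_top ENNReal.one_ne_top hT
  have hr0 := hΦ.youngInv_pos hu0
  have hrt := hΦ.youngInv_ne_top hΔ hut
  have hwt := hΦ.lorentzWeight_ne_top ht
  have hw0 : lorentzWeight Φ t ≠ 0 := by
    rw [lorentzWeight_eq ht, ENNReal.inv_ne_zero]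
    exact ENNReal.mul_ne_top hrt ENNReal.ofReal_ne_top
  have hwr : lorentzWeight Φ t * youngInv Φ (1 / ENNReal.ofReal t) = 1 / ENNReal.ofReal t := by
    rw [lorentzWeight, div_eq_mul_inv, mul_right_comm, ENNReal.inv_mul_cancel hr0 hrt, one_mul,
      one_div]
  have hc := hΦ.le_complementaryFunction hΔ hu0 hut (b := 4 * lorentzWeight Φ t)
    (by rw [mul_assoc, hwr])
  lift lorentzWeight Φ t to ℝ≥0 using hwt with b hb
  have hb0 : 0 < 4 * b := by
    have : b ≠ 0 := by simpa using hw0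
    positivity
  have h4 : (4 : ℝ≥0∞) * b = ((4 * b : ℝ≥0) : ℝ≥0∞) := by push_cast; rfl
  have h := hg (4 * b) hb0
  rw [h4] at hc
  have hd : distribFun g (l * (4 * b)) ≤ ENNReal.ofReal t := by
    have h1 : 1 / ENNReal.ofReal t * distribFun g (l * (4 * b)) ≤ 1 :=
      le_trans (by gcongr) h
    calc distribFun g (l * (4 * b))
        = ENNReal.ofReal t * (1 / ENNReal.ofReal t * distribFun g (l * (4 * b))) := by
          rw [one_div, ENNReal.mul_inv_cancel_left hT ENNReal.ofReal_ne_top]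
      _ ≤ ENNReal.ofReal t * 1 := by gcongr
      _ = _ := mul_one _
  calc rearrangement g (ENNReal.ofReal t) ≤ ((l * (4 * b) : ℝ≥0) : ℝ≥0∞) :=
        iInf₂_le _ ⟨mul_pos hl hb0, hd⟩
    _ = 4 * l * b := by push_cast; ring

/-- Level sets of `g` inside `A` have measure at most `min(m(g,b), |A|)`, so the integral is bounded
by that of `g*` over `(0, |A|)`. -/
theorem setLIntegral_enorm_le_of_weak (hΦ : IsYoungFunction Φ) (hΔ : DeltaTwo Φ)
    {g : EuclideanSpace ℝ (Fin n) → 𝕜} (hgm : Measurable g) {l : ℝ≥0} (hl : 0 < l)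
    (hg : ∀ t : ℝ≥0, 0 < t → complementaryFunction Φ t * distribFun g (l * t) ≤ 1)
    (A : Set (EuclideanSpace ℝ (Fin n))) :
    ∫⁻ x in A, ‖g x‖ₑ ≤ 4 * l * lorentzPrimitive Φ (volume A) := by
  have hms : ∀ s, MeasurableSet {t | ENNReal.ofReal t < s} := fun s =>
    measurableSet_lt ENNReal.measurable_ofReal measurable_const
  calc ∫⁻ x in A, ‖g x‖ₑ = ∫⁻ x in A, ENNReal.ofReal ‖g x‖ := by
        simp only [ofReal_norm]
    _ = ∫⁻ b in Ioi (0 : ℝ), volume.restrict A {x | b < ‖g x‖} :=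
        lintegral_eq_lintegral_meas_lt _ (Eventually.of_forall fun x => norm_nonneg _)
          hgm.norm.aemeasurable
    _ ≤ ∫⁻ b in Ioi (0 : ℝ), ∫⁻ t in Ioi (0 : ℝ),
        {t | ENNReal.ofReal t < distribFun g b.toNNReal}.indicator
          ({t | ENNReal.ofReal t < volume A}.indicator 1) t := by
        refine setLIntegral_mono' measurableSet_Ioi fun b hb => ?_
        have h1 : volume.restrict A {x | b < ‖g x‖} ≤ min (distribFun g b.toNNReal) (volume A) := by
          rw [Measure.restrict_apply (measurableSet_lt measurable_const hgm.norm),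
            distribFun_toNNReal g hb]
          exact le_min (measure_mono inter_subset_left) (measure_mono inter_subset_right)
        refine h1.trans (le_of_eq ?_)
        rw [← volume_ofReal_lt (min _ _)]
        refine lintegral_congr fun t => ?_
        rw [indicator_indicator]
        congr 1
        ext t
        simp
    _ = ∫⁻ t in Ioi (0 : ℝ), {t | ENNReal.ofReal t < volume A}.indicator 1 t
          * rearrangement g (ENNReal.ofReal t) :=
        (lintegral_swap_distribFun g (measurable_one.indicator (hms _))).symm
    _ ≤ ∫⁻ t in Ioi (0 : ℝ), 4 * l *
          {t | ENNReal.ofReal t < volume A}.indicator (lorentzWeight Φ) t := by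
        refine setLIntegral_mono' measurableSet_Ioi fun t ht => ?_
        by_cases h : ENNReal.ofReal t < volume A
        · simpa [indicator, h] using rearrangement_le_of_weak hΦ hΔ hl hg ht
        · simp [indicator, h]
    _ = _ := lintegral_const_mul _ (measurable_lorentzWeight.indicator (hms _))

/-- The Hölder inequality between `L^{Φ,1}` and `wL^{Φ̃}`. -/
theorem lintegral_enorm_mul_le_of_weak (hΦ : IsYoungFunction Φ) (hΔ : DeltaTwo Φ)
    {f g : EuclideanSpace ℝ (Fin n) → 𝕜} (hfm : Measurable f) (hgm : Measurable g) {l : ℝ≥0}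
    (hl : 0 < l)
    (hg : ∀ t : ℝ≥0, 0 < t → complementaryFunction Φ t * distribFun g (l * t) ≤ 1) :
    ∫⁻ x, ‖f x * g x‖ₑ ≤ 4 * l * orliczLorentzNorm Φ f := by
  calc ∫⁻ x, ‖f x * g x‖ₑ = ∫⁻ x, ‖g x‖ₑ * ‖f x‖ₑ := by
        simp only [enorm_mul, mul_comm]
    -- Layer cake for `|f|` against the measure `|g| dx`: only integrals of `|g|` over level sets of
    -- `f` remain.
    _ = ∫⁻ x, ENNReal.ofReal ‖f x‖ ∂(volume.withDensity fun x => ‖g x‖ₑ) := by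
        rw [lintegral_withDensity_eq_lintegral_mul _ hgm.enorm hfm.norm.ennreal_ofReal]
        simp only [Pi.mul_apply, ofReal_norm]
    _ = ∫⁻ a in Ioi (0 : ℝ), (volume.withDensity fun x => ‖g x‖ₑ) {x | a < ‖f x‖} :=
        lintegral_eq_lintegral_meas_lt _ (Eventually.of_forall fun x => norm_nonneg _)
          hfm.norm.aemeasurable
    _ ≤ ∫⁻ a in Ioi (0 : ℝ), 4 * l * lorentzPrimitive Φ (distribFun f a.toNNReal) := by
        refine setLIntegral_mono' measurableSet_Ioi fun a ha => ?_
        rw [withDensity_apply _ (measurableSet_lt measurable_const hfm.norm),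
          distribFun_toNNReal f ha]
        exact setLIntegral_enorm_le_of_weak hΦ hΔ hgm hl hg _
    _ = _ := by
        have hm : Measurable fun a : ℝ => lorentzPrimitive Φ (distribFun f a.toNNReal) :=
          lorentzPrimitive_mono.measurable.comp (measurable_distribFun_toNNReal f)
        rw [lintegral_const_mul _ hm, orliczLorentzNorm_eq_lintegral]

/-! ### Functionals evaluated on functions -/

/-- The class in `L^{Φ,1}` of a measurable function of finite quasi-norm. -/
noncomputable def orliczLorentz.mk (hΦ : IsYoungFunction Φ) (u : EuclideanSpace ℝ (Fin n) → 𝕜)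
    (hu : Measurable u) (hn : orliczLorentzNorm Φ u ≠ ∞) : orliczLorentz n 𝕜 hΦ :=
  ⟨AEEqFun.mk u hu.aestronglyMeasurable, by
    change orliczLorentzNorm Φ _ < ∞
    rw [orliczLorentzNorm_congr Φ (AEEqFun.coeFn_mk u hu.aestronglyMeasurable)]
    exact hn.lt_top⟩

theorem orliczLorentz.coeFn_mk (hΦ : IsYoungFunction Φ) {u : EuclideanSpace ℝ (Fin n) → 𝕜}
    (hu : Measurable u) (hn : orliczLorentzNorm Φ u ≠ ∞) :
    (orliczLorentz.mk hΦ u hu hn).1 =ᵐ[volume] u :=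
  AEEqFun.coeFn_mk u hu.aestronglyMeasurable

theorem orliczLorentz.measurable_coe {hΦ : IsYoungFunction Φ} (f : orliczLorentz n 𝕜 hΦ) :
    Measurable f.1 := f.1.stronglyMeasurable.measurable

theorem orliczLorentz.norm_ne_top {hΦ : IsYoungFunction Φ} (f : orliczLorentz n 𝕜 hΦ) :
    orliczLorentzNorm Φ f.1 ≠ ∞ := (show orliczLorentzNorm Φ f.1 < ∞ from f.2).ne

theorem orliczLorentzNorm_add_ne_top (hΦ : IsYoungFunction Φ)
    {u v : EuclideanSpace ℝ (Fin n) → 𝕜} (hu : orliczLorentzNorm Φ u ≠ ∞)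
    (hv : orliczLorentzNorm Φ v ≠ ∞) : orliczLorentzNorm Φ (fun x => u x + v x) ≠ ∞ :=
  ne_top_of_le_ne_top (by finiteness) (orliczLorentzNorm_add_le hΦ u v)

theorem orliczLorentzNorm_const_mul_ne_top (c : 𝕜)
    {u : EuclideanSpace ℝ (Fin n) → 𝕜} (hu : orliczLorentzNorm Φ u ≠ ∞) :
    orliczLorentzNorm Φ (fun x => c * u x) ≠ ∞ :=
  ne_top_of_le_ne_top (by finiteness) (orliczLorentzNorm_const_mul_le Φ c u)

open scoped Classical in
/-- The value of a linear form on `L^{Φ,1}` at the class of a function, extended by zero. -/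
noncomputable def evalFun {hΦ : IsYoungFunction Φ} (T : orliczLorentz n 𝕜 hΦ →ₗ[𝕜] 𝕜)
    (u : EuclideanSpace ℝ (Fin n) → 𝕜) : 𝕜 :=
  if h : Measurable u ∧ orliczLorentzNorm Φ u ≠ ∞ then T (orliczLorentz.mk hΦ u h.1 h.2) else 0

section evalFun

variable {hΦ : IsYoungFunction Φ} {T : orliczLorentz n 𝕜 hΦ →ₗ[𝕜] 𝕜}
  {u v : EuclideanSpace ℝ (Fin n) → 𝕜}

theorem evalFun_eq (hu : Measurable u) (hn : orliczLorentzNorm Φ u ≠ ∞) :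
    evalFun T u = T (orliczLorentz.mk hΦ u hu hn) := dif_pos ⟨hu, hn⟩

theorem evalFun_coe (f : orliczLorentz n 𝕜 hΦ) : evalFun T f.1 = T f := by
  rw [evalFun_eq (orliczLorentz.measurable_coe f) (orliczLorentz.norm_ne_top f)]
  congr 1
  exact Subtype.ext (AEEqFun.mk_coeFn f.1)

theorem evalFun_add (hu : Measurable u) (hun : orliczLorentzNorm Φ u ≠ ∞) (hv : Measurable v)
    (hvn : orliczLorentzNorm Φ v ≠ ∞) :
    evalFun T (fun x => u x + v x) = evalFun T u + evalFun T v := by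
  have huv : Measurable fun x => u x + v x := hu.add hv
  rw [evalFun_eq hu hun, evalFun_eq hv hvn,
    evalFun_eq huv (orliczLorentzNorm_add_ne_top hΦ hun hvn), ← map_add]
  rfl

theorem evalFun_const_mul (c : 𝕜) (hu : Measurable u) (hun : orliczLorentzNorm Φ u ≠ ∞) :
    evalFun T (fun x => c * u x) = c * evalFun T u := by
  rw [evalFun_eq hu hun,
    evalFun_eq (hu.const_mul c) (orliczLorentzNorm_const_mul_ne_top c hun), ← smul_eq_mul,
    ← map_smul]
  rfl

theorem enorm_evalFun_le {D : ℝ≥0} (hD : ∀ f, ‖T f‖ₑ ≤ D * orliczLorentzNorm Φ f.1)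
    (u : EuclideanSpace ℝ (Fin n) → 𝕜) : ‖evalFun T u‖ₑ ≤ D * orliczLorentzNorm Φ u := by
  by_cases h : Measurable u ∧ orliczLorentzNorm Φ u ≠ ∞
  · rw [evalFun_eq h.1 h.2]
    refine (hD _).trans (le_of_eq ?_)
    rw [orliczLorentzNorm_congr Φ (orliczLorentz.coeFn_mk hΦ h.1 h.2)]
  · rw [evalFun, dif_neg h]
    simp

theorem evalFun_sub (hu : Measurable u) (hun : orliczLorentzNorm Φ u ≠ ∞) (hv : Measurable v)
    (hvn : orliczLorentzNorm Φ v ≠ ∞) :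
    evalFun T (fun x => u x - v x) = evalFun T u - evalFun T v := by
  have h := evalFun_add (T := T) hu hun (hv.const_mul (-1))
    (orliczLorentzNorm_const_mul_ne_top (-1) hvn)
  rw [evalFun_const_mul _ hv hvn] at h
  simpa [sub_eq_add_neg] using h

/-- Order continuity applied to `u j - v`, dominated by `2F`. The filter is general because both
sequences and finite subsets of `ℕ` serve as index. -/
theorem tendsto_evalFun (hΔ : DeltaTwo Φ) {D : ℝ≥0}
    (hD : ∀ f, ‖T f‖ₑ ≤ D * orliczLorentzNorm Φ f.1) {ι : Type*} {l : Filter ι}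
    [l.IsCountablyGenerated] {F : EuclideanSpace ℝ (Fin n) → 𝕜}
    {u : ι → EuclideanSpace ℝ (Fin n) → 𝕜} {v : EuclideanSpace ℝ (Fin n) → 𝕜}
    (hF : Measurable F) (hu : ∀ j, Measurable (u j)) (hv : Measurable v)
    (hFn : orliczLorentzNorm Φ F ≠ ∞) (hle : ∀ j x, ‖u j x‖ ≤ ‖F x‖) (hlev : ∀ x, ‖v x‖ ≤ ‖F x‖)
    (hlim : ∀ x, Tendsto (fun j => u j x) l (𝓝 (v x))) :
    Tendsto (fun j => evalFun T (u j)) l (𝓝 (evalFun T v)) := by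
  have hvn : orliczLorentzNorm Φ v ≠ ∞ := ne_top_of_le_ne_top hFn (orliczLorentzNorm_mono hlev)
  have hun : ∀ j, orliczLorentzNorm Φ (u j) ≠ ∞ := fun j =>
    ne_top_of_le_ne_top hFn (orliczLorentzNorm_mono (hle j))
  have h0 : Tendsto (fun j => orliczLorentzNorm Φ (fun x => u j x - v x)) l (𝓝 0) := by
    refine tendsto_orliczLorentzNorm_zero hΦ hΔ (hF.const_mul 2) (fun j => (hu j).sub hv)
      (orliczLorentzNorm_const_mul_ne_top 2 hFn) (fun j x => ?_) (fun x => ?_)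
    · calc ‖u j x - v x‖ ≤ ‖u j x‖ + ‖v x‖ := norm_sub_le _ _
        _ ≤ ‖F x‖ + ‖F x‖ := add_le_add (hle j x) (hlev x)
        _ = ‖2 * F x‖ := by rw [norm_mul, RCLike.norm_ofNat]; ring
    · simpa using (hlim x).sub_const (v x)
  rw [tendsto_iff_edist_tendsto_0]
  have h1 : Tendsto (fun j => (D : ℝ≥0∞) * orliczLorentzNorm Φ (fun x => u j x - v x)) l (𝓝 0) := by
    simpa using ENNReal.Tendsto.const_mul h0 (Or.inr ENNReal.coe_ne_top)
  refine tendsto_of_tendsto_of_tendsto_of_le_of_le tendsto_const_nhds h1 (fun _ => zero_le)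
    fun j => ?_
  change edist (evalFun T (u j)) (evalFun T v) ≤ _
  rw [edist_eq_enorm_sub, ← evalFun_sub (hu j) (hun j) hv hvn]
  exact enorm_evalFun_le hD _

end evalFun

/-! ### An integral density for a functional -/

section representation

variable {hΦ : IsYoungFunction Φ} {T : orliczLorentz n 𝕜 hΦ →ₗ[𝕜] 𝕜}
  {w : EuclideanSpace ℝ (Fin n) → 𝕜}

theorem orliczLorentzNorm_mul_ne_top (hwn : orliczLorentzNorm Φ w ≠ ∞)
    {b : EuclideanSpace ℝ (Fin n) → 𝕜} {c : ℝ} (hb : ∀ x, ‖b x‖ ≤ c) :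
    orliczLorentzNorm Φ (fun x => w x * b x) ≠ ∞ := by
  refine ne_top_of_le_ne_top (orliczLorentzNorm_const_mul_ne_top (c : 𝕜) hwn)
    (orliczLorentzNorm_mono fun x => ?_)
  rw [norm_mul, norm_mul, mul_comm]
  gcongr
  exact (hb x).trans ((le_abs_self c).trans (by simp))

theorem norm_indicator_one_le (A : Set (EuclideanSpace ℝ (Fin n))) (x) :
    ‖A.indicator (1 : EuclideanSpace ℝ (Fin n) → 𝕜) x‖ ≤ 1 := by
  by_cases h : x ∈ A <;> simp [h]

open scoped Classical in
-- Finite additivity is linearity; the passage to the union is dominated convergence along finite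
-- subsets, with `w` as the dominating function.
theorem hasSum_evalFun_indicator (hΔ : DeltaTwo Φ) {D : ℝ≥0}
    (hD : ∀ f, ‖T f‖ₑ ≤ D * orliczLorentzNorm Φ f.1) (hw : Measurable w)
    (hwn : orliczLorentzNorm Φ w ≠ ∞) {A : ℕ → Set (EuclideanSpace ℝ (Fin n))}
    (hA : ∀ i, MeasurableSet (A i)) (hd : Pairwise (Function.onFun Disjoint A)) :
    HasSum (fun i => evalFun T (fun x => w x * (A i).indicator 1 x))
      (evalFun T (fun x => w x * (⋃ i, A i).indicator 1 x)) := by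
  have hm : ∀ {B : Set (EuclideanSpace ℝ (Fin n))}, MeasurableSet B →
      Measurable fun x => w x * B.indicator 1 x := fun hB =>
    hw.mul (measurable_one.indicator hB)
  have hn : ∀ B : Set (EuclideanSpace ℝ (Fin n)),
      orliczLorentzNorm Φ (fun x => w x * B.indicator 1 x) ≠ ∞ := fun B =>
    orliczLorentzNorm_mul_ne_top hwn (norm_indicator_one_le B)
  have hle : ∀ (B : Set (EuclideanSpace ℝ (Fin n))) x, ‖w x * B.indicator 1 x‖ ≤ ‖w x‖ :=
    fun B x => by
      rw [norm_mul]
      exact mul_le_of_le_one_right (norm_nonneg _) (norm_indicator_one_le B x)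
  have hsum : ∀ s : Finset ℕ, ∑ i ∈ s, evalFun T (fun x => w x * (A i).indicator 1 x)
      = evalFun T (fun x => w x * (⋃ i ∈ s, A i).indicator 1 x) := by
    intro s
    induction s using Finset.induction_on with
    | empty =>
      have := evalFun_const_mul (T := T) 0 hw hwn
      simpa using this.symm
    | insert i s hi ih =>
      rw [Finset.sum_insert hi, ih, ← evalFun_add (hm (hA i)) (hn _)
        (hm (s.measurableSet_biUnion fun i _ => hA i)) (hn _)]
      congr 1
      funext x
      have hdis : Disjoint (A i) (⋃ j ∈ s, A j) := by
        simp only [disjoint_iUnion_right]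
        intro j hj
        exact hd fun h => hi (h ▸ hj)
      rw [Finset.set_biUnion_insert, indicator_union_of_disjoint hdis, mul_add]
  unfold HasSum
  simp only [hsum, SummationFilter.unconditional_filter]
  refine tendsto_evalFun hΔ hD hw (fun s => hm (s.measurableSet_biUnion fun i _ => hA i))
    (hm (MeasurableSet.iUnion hA)) hwn (fun s => hle _) (hle _) fun x => ?_
  refine tendsto_const_nhds.congr' ?_
  by_cases hx : x ∈ ⋃ i, A i
  · obtain ⟨i, hi⟩ := mem_iUnion.1 hx
    filter_upwards [eventually_ge_atTop {i}] with s hs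
    rw [indicator_of_mem hx, indicator_of_mem]
    exact mem_biUnion (Finset.singleton_subset_iff.1 hs) hi
  · refine Eventually.of_forall fun s => ?_
    dsimp only
    rw [indicator_of_notMem hx, indicator_of_notMem]
    exact fun h => hx (iUnion₂_subset (fun i _ => subset_iUnion A i) h)

open scoped Classical in
/-- The vector measure `A ↦ T (w 1_A)`. -/
noncomputable def evalMeasure (hΔ : DeltaTwo Φ) {D : ℝ≥0}
    (hD : ∀ f, ‖T f‖ₑ ≤ D * orliczLorentzNorm Φ f.1) (hw : Measurable w)
    (hwn : orliczLorentzNorm Φ w ≠ ∞) : VectorMeasure (EuclideanSpace ℝ (Fin n)) 𝕜 where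
  measureOf' A := if MeasurableSet A then evalFun T (fun x => w x * A.indicator 1 x) else 0
  empty' := by
    have := evalFun_const_mul (T := T) 0 hw hwn
    simpa using this
  not_measurable' A hA := if_neg hA
  m_iUnion' A hA hd := by
    simp only [hA, MeasurableSet.iUnion hA, if_true]
    exact hasSum_evalFun_indicator hΔ hD hw hwn hA hd

theorem evalFun_eq_zero_of_ae {D : ℝ≥0} (hD : ∀ f, ‖T f‖ₑ ≤ D * orliczLorentzNorm Φ f.1)
    {u : EuclideanSpace ℝ (Fin n) → 𝕜} (hu : u =ᵐ[volume] fun _ => 0) : evalFun T u = 0 := by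
  have h := enorm_evalFun_le hD u
  rw [orliczLorentzNorm_congr Φ hu, orliczLorentzNorm_zero, mul_zero] at h
  simpa using h

theorem exists_integrable_evalFun_indicator (hΔ : DeltaTwo Φ) {D : ℝ≥0}
    (hD : ∀ f, ‖T f‖ₑ ≤ D * orliczLorentzNorm Φ f.1) (hw : Measurable w)
    (hwn : orliczLorentzNorm Φ w ≠ ∞) :
    ∃ h : EuclideanSpace ℝ (Fin n) → 𝕜, Measurable h ∧ Integrable h ∧
      ∀ A, MeasurableSet A → evalFun T (fun x => w x * A.indicator 1 x) = ∫ x in A, h x := by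
  set ν := evalMeasure hΔ hD hw hwn with hν
  have hνA : ∀ A, MeasurableSet A → ν A = evalFun T (fun x => w x * A.indicator 1 x) :=
    fun A hA => if_pos hA
  have hac : ∀ A, MeasurableSet A → volume A = 0 → ν A = 0 := by
    intro A hA h0
    rw [hνA A hA]
    refine evalFun_eq_zero_of_ae hD ?_
    filter_upwards [measure_eq_zero_iff_ae_notMem.1 h0] with x hx
    simp [hx]
  -- Radon–Nikodym is applied to a signed measure, hence to the real and imaginary parts separately.
  have key : ∀ ρ : 𝕜 →L[ℝ] ℝ, ∃ k : EuclideanSpace ℝ (Fin n) → ℝ, Measurable k ∧ Integrable k ∧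
      ∀ A, MeasurableSet A → ρ (ν A) = ∫ x in A, k x := by
    intro ρ
    let σ : SignedMeasure (EuclideanSpace ℝ (Fin n)) :=
      ν.mapRange (ρ : 𝕜 →+ ℝ) ρ.continuous
    have hσ : ∀ A, σ A = ρ (ν A) := fun A => rfl
    have hσac : σ ≪ᵥ (volume : Measure (EuclideanSpace ℝ (Fin n))).toENNRealVectorMeasure := by
      intro A hA0
      by_cases hA : MeasurableSet A
      · rw [Measure.toENNRealVectorMeasure_apply_measurable hA] at hA0
        rw [hσ, hac A hA hA0, map_zero]
      · exact σ.not_measurable hA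
    have hint := SignedMeasure.integrable_rnDeriv σ (volume : Measure (EuclideanSpace ℝ (Fin n)))
    refine ⟨σ.rnDeriv volume, SignedMeasure.measurable_rnDeriv _ _, hint, fun A hA => ?_⟩
    rw [← hσ, ← withDensityᵥ_apply hint hA, SignedMeasure.withDensityᵥ_rnDeriv_eq σ _ hσac]
  obtain ⟨k₁, hk₁m, hk₁, hk₁A⟩ := key RCLike.reCLM
  obtain ⟨k₂, hk₂m, hk₂, hk₂A⟩ := key RCLike.imCLM
  refine ⟨fun x => (k₁ x : 𝕜) + (k₂ x : 𝕜) * RCLike.I, by fun_prop,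
    hk₁.ofReal.add (hk₂.ofReal.mul_const _), fun A hA => ?_⟩
  have i₁ : Integrable (fun x => (k₁ x : 𝕜)) (volume.restrict A) := hk₁.ofReal.integrableOn
  have i₂ : Integrable (fun x => (k₂ x : 𝕜) * RCLike.I) (volume.restrict A) :=
    (hk₂.ofReal.mul_const _).integrableOn
  rw [integral_add i₁ i₂, integral_mul_const, integral_ofReal, integral_ofReal, ← hk₁A A hA, ← hk₂A A hA, ← hνA A hA]
  exact (RCLike.re_add_im _).symm

theorem MeasureTheory.Integrable.bdd_mul_of_measurable {h b : EuclideanSpace ℝ (Fin n) → 𝕜}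
    (hh : Integrable h) (hb : Measurable b) {c : ℝ} (hc : ∀ x, ‖b x‖ ≤ c) :
    Integrable fun x => b x * h x :=
  hh.bdd_mul hb.aestronglyMeasurable (Eventually.of_forall hc)

/-- Linearity settles simple functions; uniformly bounded simple approximations of `b` then allow
dominated convergence on both sides. -/
theorem exists_integrable_evalFun (hΔ : DeltaTwo Φ) {D : ℝ≥0}
    (hD : ∀ f, ‖T f‖ₑ ≤ D * orliczLorentzNorm Φ f.1) (hw : Measurable w)
    (hwn : orliczLorentzNorm Φ w ≠ ∞) :
    ∃ h : EuclideanSpace ℝ (Fin n) → 𝕜, Measurable h ∧ Integrable h ∧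
      ∀ (b : EuclideanSpace ℝ (Fin n) → 𝕜) (c : ℝ), Measurable b → (∀ x, ‖b x‖ ≤ c) →
        evalFun T (fun x => w x * b x) = ∫ x, b x * h x := by
  obtain ⟨h, hm, hi, hA⟩ := exists_integrable_evalFun_indicator hΔ hD hw hwn
  refine ⟨h, hm, hi, fun b c hb hbc => ?_⟩
  have hsimple : ∀ s : SimpleFunc (EuclideanSpace ℝ (Fin n)) 𝕜,
      evalFun T (fun x => w x * s x) = ∫ x, s x * h x := by
    intro s
    induction s using SimpleFunc.induction with
    | const a hB =>
      rename_i B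
      have e1 : (fun x => w x * (SimpleFunc.piecewise B hB (SimpleFunc.const _ a)
          (SimpleFunc.const _ 0)) x) = fun x => a * (w x * B.indicator 1 x) := by
        funext x
        by_cases hx : x ∈ B <;> simp [hx, mul_comm]
      have e2 : (fun x => (SimpleFunc.piecewise B hB (SimpleFunc.const _ a)
          (SimpleFunc.const _ 0)) x * h x) = fun x => a * B.indicator h x := by
        funext x
        by_cases hx : x ∈ B <;> simp [hx]
      have hwB : Measurable fun x => w x * B.indicator 1 x :=
        hw.mul (measurable_one.indicator hB)
      rw [e1, e2, evalFun_const_mul a hwB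
        (orliczLorentzNorm_mul_ne_top hwn (norm_indicator_one_le B)), hA B hB, integral_const_mul,
        integral_indicator hB]
    | add _ h₁ h₂ =>
      rename_i s₁ s₂ _
      obtain ⟨c₁, hc₁⟩ := s₁.exists_forall_norm_le
      obtain ⟨c₂, hc₂⟩ := s₂.exists_forall_norm_le
      simp only [SimpleFunc.coe_add, Pi.add_apply, mul_add, add_mul]
      have m₁ : Measurable fun x => w x * s₁ x := hw.mul s₁.measurable
      have m₂ : Measurable fun x => w x * s₂ x := hw.mul s₂.measurable
      rw [evalFun_add m₁ (orliczLorentzNorm_mul_ne_top hwn hc₁) m₂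
        (orliczLorentzNorm_mul_ne_top hwn hc₂), h₁, h₂,
        integral_add (hi.bdd_mul_of_measurable s₁.measurable hc₁)
          (hi.bdd_mul_of_measurable s₂.measurable hc₂)]
  have hbs : StronglyMeasurable b := hb.stronglyMeasurable
  have hc0 : 0 ≤ c := (norm_nonneg _).trans (hbc 0)
  have hsb : ∀ j x, ‖hbs.approxBounded c j x‖ ≤ c := fun j x => hbs.norm_approxBounded_le hc0 j x
  have hlim : ∀ x, Tendsto (fun j => hbs.approxBounded c j x) atTop (𝓝 (b x)) := fun x =>
    hbs.tendsto_approxBounded_of_norm_le (hbc x)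
  have hle : ∀ {v : EuclideanSpace ℝ (Fin n) → 𝕜}, (∀ x, ‖v x‖ ≤ c) → ∀ x,
      ‖w x * v x‖ ≤ ‖(c : 𝕜) * w x‖ := fun hv x => by
    rw [norm_mul, norm_mul, mul_comm, RCLike.norm_ofReal, abs_of_nonneg hc0]
    gcongr
    exact hv x
  have hL := tendsto_evalFun (T := T) hΔ hD (hw.const_mul (c : 𝕜))
    (fun j => hw.mul (hbs.approxBounded c j).measurable) (hw.mul hb)
    (orliczLorentzNorm_const_mul_ne_top _ hwn) (fun j => hle (hsb j)) (hle hbc)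
    (fun x => (hlim x).const_mul (w x))
  have hR : Tendsto (fun j => ∫ x, hbs.approxBounded c j x * h x) atTop (𝓝 (∫ x, b x * h x)) := by
    refine tendsto_integral_of_dominated_convergence (fun x => c * ‖h x‖)
      (fun j => ((hbs.approxBounded c j).measurable.mul hm).aestronglyMeasurable)
      (hi.norm.const_mul c) (fun j => Eventually.of_forall fun x => ?_)
      (Eventually.of_forall fun x => (hlim x).mul_const _)
    rw [norm_mul]
    gcongr
    exact hsb j x
  refine tendsto_nhds_unique hL (hR.congr fun j => ?_)
  exact (hsimple _).symm

end representation

/-! ### From bounded pairings to the weak condition -/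

theorem orliczLorentzNorm_le_of_indicator {A : Set (EuclideanSpace ℝ (Fin n))}
    {u : EuclideanSpace ℝ (Fin n) → 𝕜} (hu : ∀ x, ‖u x‖ ≤ A.indicator 1 x) :
    orliczLorentzNorm Φ u ≤ lorentzPrimitive Φ (volume A) := by
  rw [orliczLorentzNorm_eq_lintegral]
  calc ∫⁻ a in Ioi (0 : ℝ), lorentzPrimitive Φ (distribFun u a.toNNReal)
      ≤ ∫⁻ a in Ioi (0 : ℝ),
        (Iio (1 : ℝ)).indicator (fun _ => lorentzPrimitive Φ (volume A)) a := by
        refine setLIntegral_mono' measurableSet_Ioi fun a ha => ?_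
        rw [distribFun_toNNReal u ha]
        rcases lt_or_ge a 1 with h | h
        · rw [indicator_of_mem (by exact h)]
          refine lorentzPrimitive_mono (measure_mono fun x hx => ?_)
          by_contra hxA
          have h1 := hu x
          rw [indicator_of_notMem hxA] at h1
          exact (lt_trans ha hx).not_ge h1
        · have : {x | a < ‖u x‖} = ∅ := by
            ext x
            simp only [mem_ofPred_eq, mem_empty_iff_false, iff_false, not_lt]
            refine ((hu x).trans ?_).trans h
            by_cases hxA : x ∈ A <;> simp [hxA]
          rw [this, measure_empty, lorentzPrimitive_zero]
          exact zero_le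
    _ = lorentzPrimitive Φ (volume A) := by
        rw [setLIntegral_indicator measurableSet_Iio, Iio_inter_Ioi]
        simp

/-- A function whose pairing with `w b` is controlled by the norm of `w b`, for all bounded
measurable `b`, satisfies the weak-type condition of `Φ̃`. -/
theorem weak_of_enorm_integral_le (hΦ : IsYoungFunction Φ) (hΔ : DeltaTwo Φ) {C : ℝ≥0}
    (hC : ∀ s : ℝ≥0∞, s ≠ 0 → s ≠ ∞ → lorentzPrimitive Φ s ≤ C * (youngInv Φ (1 / s))⁻¹)
    {w : EuclideanSpace ℝ (Fin n) → ℝ} (hw : Measurable w) (hw0 : ∀ x, 0 < w x)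
    {g : EuclideanSpace ℝ (Fin n) → 𝕜} (hg : Measurable g)
    (hi : Integrable fun x => (w x : 𝕜) * g x) {D : ℝ≥0} (hCD : 0 < C * D)
    (hD : ∀ (b : EuclideanSpace ℝ (Fin n) → 𝕜) (c : ℝ), Measurable b → (∀ x, ‖b x‖ ≤ c) →
      ‖∫ x, (w x * b x) * g x‖ₑ ≤ D * orliczLorentzNorm Φ (fun x => (w x : 𝕜) * b x))
    {t : ℝ≥0} (ht : 0 < t) :
    complementaryFunction Φ t * distribFun g (2 * C * D * t) ≤ 1 := by
  set L := 2 * C * D * t with hL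
  -- Bounding `w` below on `E j` keeps the test function `b` bounded; the sets increase to the whole
  -- level set since `w > 0`.
  let E : ℕ → Set (EuclideanSpace ℝ (Fin n)) := fun j =>
    {x | L < ‖g x‖₊} ∩ {x | 1 / ((j : ℝ) + 1) ≤ w x}
  have hEm : ∀ j, MeasurableSet (E j) := fun j =>
    (measurableSet_lt measurable_const hg.nnnorm).inter (measurableSet_le measurable_const hw)
  have hEmono : Monotone E := fun i j hij =>
    inter_subset_inter_right _ fun x (hx : 1 / ((i : ℝ) + 1) ≤ w x) =>
      (Nat.one_div_le_one_div hij).trans hx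
  have hU : {x | L < ‖g x‖₊} = ⋃ j, E j := by
    rw [← inter_iUnion, eq_comm, inter_eq_left]
    intro x _
    obtain ⟨j, hj⟩ := exists_nat_one_div_lt (hw0 x)
    exact mem_iUnion.2 ⟨j, hj.le⟩
  rw [distribFun, hU, hEmono.measure_iUnion, ENNReal.mul_iSup]
  refine iSup_le fun j => ?_
  set s := volume (E j) with hs
  rcases eq_or_ne s 0 with h0 | h0
  · simp [h0]
  have hwj : ∀ x ∈ E j, 1 ≤ ((j : ℝ) + 1) * w x := fun x hx => by
    have : 1 / ((j : ℝ) + 1) ≤ w x := hx.2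
    rw [div_le_iff₀ (by positivity)] at this
    linarith
  have hgfin : ∫⁻ x in E j, ‖g x‖ₑ ≠ ∞ := by
    have h1 : IntegrableOn g (E j) := by
      refine ((hi.norm.const_mul ((j : ℝ) + 1)).integrableOn (s := E j)).mono'
        hg.aestronglyMeasurable ((ae_restrict_iff' (hEm j)).2 (Eventually.of_forall fun x hx => ?_))
      rw [norm_mul, RCLike.norm_ofReal, abs_of_pos (hw0 x), ← mul_assoc]
      exact le_mul_of_one_le_left (norm_nonneg _) (hwj x hx)
    exact h1.2.ne
  have hLs : (L : ℝ≥0∞) * s ≤ ∫⁻ x in E j, ‖g x‖ₑ := by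
    rw [hs, ← setLIntegral_const]
    refine setLIntegral_mono' (hEm j) fun x hx => ?_
    have : L < ‖g x‖₊ := hx.1
    exact ENNReal.coe_le_coe.2 this.le
  have hL0 : 0 < L := by
    rw [hL, mul_assoc 2]
    positivity
  -- `g` is integrable on `E j`, where `w` is bounded below, and exceeds `L > 0` there.
  have hst : s ≠ ∞ := fun h => hgfin (by
    rw [h, ENNReal.mul_top (by exact_mod_cast hL0.ne')] at hLs
    exact top_le_iff.1 hLs)
  -- Chosen so that `w b` is the conjugate phase of `g` on `E j`, hence `w b g = |g|` there.
  let b : EuclideanSpace ℝ (Fin n) → 𝕜 := (E j).indicator fun x =>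
    ((w x)⁻¹ : ℝ) * (((‖g x‖)⁻¹ : ℝ) * conj (g x))
  have hbm : Measurable b := by
    have hconj : Measurable fun x => conj (g x) := RCLike.continuous_conj.measurable.comp hg
    refine Measurable.indicator ?_ (hEm j)
    fun_prop
  have hgpos : ∀ x ∈ E j, 0 < ‖g x‖ := fun x hx => by
    have : L < ‖g x‖₊ := hx.1
    exact_mod_cast hL0.trans this
  have hwb : ∀ x, ‖(w x : 𝕜) * b x‖ ≤ (E j).indicator 1 x := fun x => by
    by_cases hx : x ∈ E j
    · simp only [b, indicator_of_mem hx, norm_mul, RCLike.norm_ofReal, RCLike.norm_conj, abs_inv,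
        abs_norm, Pi.one_apply]
      rw [inv_mul_cancel₀ (hgpos x hx).ne', mul_one, mul_inv_cancel₀ (abs_pos.2 (hw0 x).ne').ne']
    · simp [b, hx]
  have hbc : ∀ x, ‖b x‖ ≤ (j : ℝ) + 1 := fun x => by
    by_cases hx : x ∈ E j
    · have h1 := hwb x
      rw [indicator_of_mem hx, norm_mul, RCLike.norm_ofReal, abs_of_pos (hw0 x), Pi.one_apply] at h1
      have h2 := mul_le_mul_of_nonneg_right (hwj x hx) (norm_nonneg (b x))
      nlinarith
    · simp only [b, indicator_of_notMem hx, norm_zero]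
      positivity
  have hint : ∫ x, (w x * b x) * g x = ((∫ x in E j, ‖g x‖ : ℝ) : 𝕜) := by
    rw [← integral_ofReal, ← integral_indicator (hEm j)]
    refine integral_congr_ae (Eventually.of_forall fun x => ?_)
    by_cases hx : x ∈ E j
    · have h1 : (w x : 𝕜) ≠ 0 := by exact_mod_cast (hw0 x).ne'
      have h2 : ((‖g x‖ : ℝ) : 𝕜) ≠ 0 := by exact_mod_cast (hgpos x hx).ne'
      simp only [b, indicator_of_mem hx]
      push_cast
      rw [mul_inv_cancel_left₀ h1, mul_assoc, RCLike.conj_mul, pow_two, inv_mul_cancel_left₀ h2]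
    · simp [b, hx]
  have key := hD b _ hbm hbc
  rw [hint] at key
  have hkey : ∫⁻ x in E j, ‖g x‖ₑ ≤ D * (C * (youngInv Φ (1 / s))⁻¹) := by
    calc ∫⁻ x in E j, ‖g x‖ₑ = ‖((∫ x in E j, ‖g x‖ : ℝ) : 𝕜)‖ₑ := by
          rw [← ofReal_norm, RCLike.norm_ofReal,
            abs_of_nonneg (integral_nonneg fun x => norm_nonneg _),
            integral_norm_eq_lintegral_enorm hg.aestronglyMeasurable, ENNReal.ofReal_toReal hgfin]
      _ ≤ D * orliczLorentzNorm Φ (fun x => (w x : 𝕜) * b x) := key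
      _ ≤ _ := by
          gcongr
          exact (orliczLorentzNorm_le_of_indicator hwb).trans (hC s h0 hst)
  have hu0 : 1 / s ≠ 0 := by simpa using hst
  have hut : 1 / s ≠ ∞ := ENNReal.div_ne_top ENNReal.one_ne_top h0
  have hr0 := hΦ.youngInv_pos hu0
  have hrt := hΦ.youngInv_ne_top hΔ hut
  -- From `L s ≤ C D / Φ⁻¹(1/s)` with `L = 2 C D t`, cancelling `C D` leaves `2 t Φ⁻¹(1/s) ≤ 1/s`,
  -- the hypothesis of the upper bound; this is the origin of the `2` in `L`.
  have hfin : complementaryFunction Φ t ≤ 1 / s := by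
    refine hΦ.complementaryFunction_le hΔ hu0 hut ?_
    rw [ENNReal.le_div_iff_mul_le (Or.inl h0) (Or.inl hst)]
    have h3 := hLs.trans hkey
    set r := youngInv Φ (1 / s)
    have hCD0 : ((C * D : ℝ≥0) : ℝ≥0∞) ≠ 0 := by exact_mod_cast hCD.ne'
    have h4 : ((C * D : ℝ≥0) : ℝ≥0∞) * (2 * (t * r) * s) ≤ ((C * D : ℝ≥0) : ℝ≥0∞) * 1 := by
      calc ((C * D : ℝ≥0) : ℝ≥0∞) * (2 * (t * r) * s) = L * s * r := by
            rw [hL]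
            push_cast
            ring
        _ ≤ D * (C * r⁻¹) * r := by gcongr
        _ = ((C * D : ℝ≥0) : ℝ≥0∞) * (r⁻¹ * r) := by
            push_cast
            ring
        _ = _ := by rw [ENNReal.inv_mul_cancel hr0 hrt]
    exact (ENNReal.mul_le_mul_iff_right hCD0 ENNReal.coe_ne_top).1 h4
  calc complementaryFunction Φ t * s ≤ 1 / s * s := by gcongr
    _ = 1 := ENNReal.div_mul_cancel h0 hst

/-! ### Scaling in the weak space -/

theorem distribFun_div (f : EuclideanSpace ℝ (Fin n) → 𝕜) {l : ℝ≥0} (hl : 0 < l) (t : ℝ≥0) :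
    distribFun (fun x => f x / ((l : ℝ) : 𝕜)) t = distribFun f (l * t) := by
  unfold distribFun
  congr 1
  ext x
  have : ‖((l : ℝ) : 𝕜)‖₊ = l := by
    ext
    simp
  simp only [mem_ofPred_eq, nnnorm_div, this]
  rw [lt_div_iff₀ hl, mul_comm]

theorem distribFun_ofReal_mul (f : EuclideanSpace ℝ (Fin n) → 𝕜) {k : ℝ≥0} (hk : 0 < k)
    (t : ℝ≥0) : distribFun (fun x => ((k : ℝ) : 𝕜) * f x) t = distribFun f (k⁻¹ * t) := by
  rw [← distribFun_div f (inv_pos.2 hk)]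
  congr 1
  funext x
  rw [div_eq_mul_inv, mul_comm]
  push_cast
  rw [inv_inv]

theorem weakOrliczNorm_le {Ψ : ℝ≥0∞ → ℝ≥0∞} {f : EuclideanSpace ℝ (Fin n) → 𝕜} {l : ℝ≥0}
    (hl : 0 < l) (h : ∀ t : ℝ≥0, 0 < t → Ψ t * distribFun f (l * t) ≤ 1) :
    weakOrliczNorm Ψ f ≤ l :=
  iInf₂_le l ⟨hl, iSup₂_le fun t ht => by rw [distribFun_div f hl]; exact h t ht⟩

theorem memWeakOrlicz_of_weak {Ψ : ℝ≥0∞ → ℝ≥0∞} {f : EuclideanSpace ℝ (Fin n) → 𝕜} {l : ℝ≥0}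
    (hl : 0 < l) (h : ∀ t : ℝ≥0, 0 < t → Ψ t * distribFun f (l * t) ≤ 1) : MemWeakOrlicz Ψ f := by
  refine ⟨(l⁻¹ : ℝ≥0), by simpa using hl, lt_of_le_of_lt (iSup₂_le fun t ht => ?_)
    ENNReal.one_lt_top⟩
  rw [distribFun_ofReal_mul f (inv_pos.2 hl), inv_inv]
  exact h t ht

/-- A finite supremum `M` is brought down to `1` by enlarging the scale by `c = max(M, 1)`, because
the complementary function at `t` is at most `1/c` times its value at `c t`. -/
theorem MemWeakOrlicz.exists_weak {f : EuclideanSpace ℝ (Fin n) → 𝕜}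
    (hf : MemWeakOrlicz (complementaryFunction Φ) f) : ∃ l : ℝ≥0, 0 < l ∧
      ∀ t : ℝ≥0, 0 < t → complementaryFunction Φ t * distribFun f (l * t) ≤ 1 := by
  obtain ⟨k, hk, hM⟩ := hf
  lift k to ℝ≥0 using hk.le
  have hk' : 0 < k := by exact_mod_cast hk
  obtain ⟨M, hM⟩ := ENNReal.lt_iff_exists_coe.1 hM
  set c : ℝ≥0 := max M 1 with hc
  have hc0 : 0 < c := lt_of_lt_of_le one_pos (le_max_right _ _)
  refine ⟨k⁻¹ * c, by positivity, fun t ht => ?_⟩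
  have h1 : complementaryFunction Φ (c * t : ℝ≥0) * distribFun f (k⁻¹ * (c * t)) ≤ M := by
    rw [← hM.1, ← distribFun_ofReal_mul f hk']
    exact le_iSup₂ (f := fun (t : ℝ≥0) (_ : 0 < t) => complementaryFunction Φ t *
      distribFun (fun x => ((k : ℝ) : 𝕜) * f x) t) (c * t) (by positivity)
  have hcE : (c : ℝ≥0∞) ≠ 0 := by exact_mod_cast hc0.ne'
  have h2 : complementaryFunction Φ t ≤ (c : ℝ≥0∞)⁻¹ * complementaryFunction Φ (c * t : ℝ≥0) := by
    have := complementaryFunction_mul_le (Φ := Φ) (θ := (c : ℝ≥0∞)⁻¹)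
      (ENNReal.inv_le_one.2 (by exact_mod_cast le_max_right M 1)) (c * t)
    rwa [ENNReal.coe_mul, ENNReal.inv_mul_cancel_left hcE ENNReal.coe_ne_top] at this
  calc complementaryFunction Φ t * distribFun f (k⁻¹ * c * t)
      ≤ (c : ℝ≥0∞)⁻¹ * complementaryFunction Φ (c * t : ℝ≥0) * distribFun f (k⁻¹ * (c * t)) := by
        rw [mul_assoc k⁻¹]
        gcongr
    _ ≤ (c : ℝ≥0∞)⁻¹ * M := by
        rw [mul_assoc]
        gcongr
    _ ≤ (c : ℝ≥0∞)⁻¹ * c := by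
        gcongr
        exact le_max_left _ _
    _ = 1 := ENNReal.inv_mul_cancel hcE ENNReal.coe_ne_top

/-! ### The pairing and its bijectivity -/

theorem integrable_mul_of_weak (hΦ : IsYoungFunction Φ) (hΔ : DeltaTwo Φ)
    {f g : EuclideanSpace ℝ (Fin n) → 𝕜} (hfm : Measurable f) (hfn : orliczLorentzNorm Φ f ≠ ∞)
    (hgm : Measurable g) {l : ℝ≥0} (hl : 0 < l)
    (hg : ∀ t : ℝ≥0, 0 < t → complementaryFunction Φ t * distribFun g (l * t) ≤ 1) :
    Integrable fun x => f x * g x :=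
  ⟨(hfm.mul hgm).aestronglyMeasurable,
    (lintegral_enorm_mul_le_of_weak hΦ hΔ hfm hgm hl hg).trans_lt (by finiteness)⟩

theorem weakOrlicz.measurable_coe {Ψ : ℝ≥0∞ → ℝ≥0∞} (g : weakOrlicz n 𝕜 Ψ) : Measurable g.1 :=
  g.1.stronglyMeasurable.measurable

theorem integrable_mul (hΦ : IsYoungFunction Φ) (hΔ : DeltaTwo Φ) (f : orliczLorentz n 𝕜 hΦ)
    (g : weakOrlicz n 𝕜 (complementaryFunction Φ)) : Integrable fun x => f.1 x * g.1 x := by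
  obtain ⟨l, hl, hg⟩ := MemWeakOrlicz.exists_weak g.2
  exact integrable_mul_of_weak hΦ hΔ (orliczLorentz.measurable_coe f) (orliczLorentz.norm_ne_top f) (weakOrlicz.measurable_coe g) hl hg

/-- The pairing `g ↦ (f ↦ ∫ f g)` of `wL^{Φ̃}` with `L^{Φ,1}`. -/
noncomputable def weakOrliczPairing (hΦ : IsYoungFunction Φ) (hΔ : DeltaTwo Φ) :
    weakOrlicz n 𝕜 (complementaryFunction Φ) →ₗ[𝕜] orliczLorentzDual n 𝕜 hΦ where
  toFun g :=
    ⟨{ toFun := fun f => ∫ x, f.1 x * g.1 x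
       map_add' := fun f₁ f₂ => by
        rw [← integral_add (integrable_mul hΦ hΔ f₁ g) (integrable_mul hΦ hΔ f₂ g)]
        refine integral_congr_ae ?_
        filter_upwards [AEEqFun.coeFn_add f₁.1 f₂.1] with x hx
        rw [Submodule.coe_add, hx, Pi.add_apply, add_mul]
       map_smul' := fun c f => by
        rw [RingHom.id_apply, smul_eq_mul, ← integral_const_mul]
        refine integral_congr_ae ?_
        filter_upwards [AEEqFun.coeFn_smul c f.1] with x hx
        rw [Submodule.coe_smul, hx, Pi.smul_apply, smul_eq_mul, mul_assoc] }, by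
      obtain ⟨l, hl, hg⟩ := MemWeakOrlicz.exists_weak g.2
      refine ⟨4 * l, fun f => (enorm_integral_le_lintegral_enorm _).trans ?_⟩
      exact_mod_cast lintegral_enorm_mul_le_of_weak hΦ hΔ (orliczLorentz.measurable_coe f) (weakOrlicz.measurable_coe g) hl hg⟩
  map_add' g₁ g₂ := by
    refine Subtype.ext (LinearMap.ext fun f => ?_)
    change ∫ x, f.1 x * (g₁ + g₂).1 x = (∫ x, f.1 x * g₁.1 x) + ∫ x, f.1 x * g₂.1 x
    rw [← integral_add (integrable_mul hΦ hΔ f g₁) (integrable_mul hΦ hΔ f g₂)]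
    refine integral_congr_ae ?_
    filter_upwards [AEEqFun.coeFn_add g₁.1 g₂.1] with x hx
    rw [Submodule.coe_add, hx, Pi.add_apply, mul_add]
  map_smul' c g := by
    refine Subtype.ext (LinearMap.ext fun f => ?_)
    change ∫ x, f.1 x * (c • g).1 x = c * ∫ x, f.1 x * g.1 x
    rw [← integral_const_mul]
    refine integral_congr_ae ?_
    filter_upwards [AEEqFun.coeFn_smul c g.1] with x hx
    rw [Submodule.coe_smul, hx, Pi.smul_apply, smul_eq_mul, mul_left_comm]

theorem weakOrliczPairing_apply (hΦ : IsYoungFunction Φ) (hΔ : DeltaTwo Φ)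
    (g : weakOrlicz n 𝕜 (complementaryFunction Φ)) (f : orliczLorentz n 𝕜 hΦ) :
    (weakOrliczPairing hΦ hΔ g).1 f = ∫ x, f.1 x * g.1 x := rfl

theorem evalFun_weakOrliczPairing (hΦ : IsYoungFunction Φ) (hΔ : DeltaTwo Φ)
    (g : weakOrlicz n 𝕜 (complementaryFunction Φ)) {u : EuclideanSpace ℝ (Fin n) → 𝕜}
    (hu : Measurable u) (hn : orliczLorentzNorm Φ u ≠ ∞) :
    evalFun (weakOrliczPairing hΦ hΔ g).1 u = ∫ x, u x * g.1 x := by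
  rw [evalFun_eq hu hn, weakOrliczPairing_apply]
  refine integral_congr_ae ?_
  filter_upwards [orliczLorentz.coeFn_mk hΦ hu hn] with x hx
  rw [hx]

theorem weakOrliczPairing_injective (hΦ : IsYoungFunction Φ) (hΔ : DeltaTwo Φ) :
    Function.Injective (weakOrliczPairing (n := n) (𝕜 := 𝕜) hΦ hΔ) := by
  rw [injective_iff_map_eq_zero]
  intro g hg
  obtain ⟨w, hwm, hw0, hwn⟩ := exists_pos_orliczLorentzNorm_ne_top n 𝕜 hΦ hΔ
  have hgm := (weakOrlicz.measurable_coe g)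
  -- Testing against `w` times the conjugate phase of `g` gives `∫ w |g| = 0`; the convention `0⁻¹ =
  -- 0` covers the zeros of `g`.
  let b : EuclideanSpace ℝ (Fin n) → 𝕜 := fun x => ((‖g.1 x‖)⁻¹ : ℝ) * conj (g.1 x)
  have hconj : Measurable fun x => conj (g.1 x) := RCLike.continuous_conj.measurable.comp hgm
  have hbm : Measurable b := by fun_prop
  have hb1 : ∀ x, ‖b x‖ ≤ 1 := fun x => by
    simp only [b, norm_mul, RCLike.norm_ofReal, RCLike.norm_conj, abs_inv, abs_norm]
    exact inv_mul_le_one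
  have hwbm : Measurable fun x => (w x : 𝕜) * b x := by fun_prop
  have hwbn := orliczLorentzNorm_mul_ne_top hwn hb1
  have h0 := evalFun_weakOrliczPairing hΦ hΔ g hwbm hwbn
  have e : ∀ x, (w x : 𝕜) * b x * g.1 x = ((w x * ‖g.1 x‖ : ℝ) : 𝕜) := fun x => by
    rcases eq_or_ne (g.1 x) 0 with h | h
    · simp [h]
    have h2 : ((‖g.1 x‖ : ℝ) : 𝕜) ≠ 0 := by exact_mod_cast (norm_pos_iff.2 h).ne'
    simp only [b]
    push_cast
    rw [mul_assoc, mul_assoc, RCLike.conj_mul, pow_two, inv_mul_cancel_left₀ h2]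
  simp only [e] at h0
  have hint : Integrable fun x => w x * ‖g.1 x‖ := by
    obtain ⟨l, hl, hgl⟩ := MemWeakOrlicz.exists_weak g.2
    have h1 := (integrable_mul_of_weak hΦ hΔ (by fun_prop) hwn hgm hl hgl).norm
    refine h1.congr (Eventually.of_forall fun x => ?_)
    simp [abs_of_pos (hw0 x)]
  have hz : evalFun (weakOrliczPairing hΦ hΔ g).1 (fun x => (w x : 𝕜) * b x) = 0 := by
    rw [hg, evalFun_eq hwbm hwbn]
    rfl
  rw [hz, integral_ofReal, eq_comm, RCLike.ofReal_eq_zero,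
    integral_eq_zero_iff_of_nonneg (fun x => mul_nonneg (hw0 x).le (norm_nonneg _)) hint] at h0
  refine Subtype.ext (AEEqFun.ext ?_)
  filter_upwards [h0, AEEqFun.coeFn_zero (μ := volume) (α := EuclideanSpace ℝ (Fin n)) (β := 𝕜)]
    with x hx hx0
  rw [Submodule.coe_zero, hx0]
  simpa [(hw0 x).ne'] using hx

theorem weakOrliczPairing_surjective (hΦ : IsYoungFunction Φ) (hΔ : DeltaTwo Φ) :
    Function.Surjective (weakOrliczPairing (n := n) (𝕜 := 𝕜) hΦ hΔ) := by
  rintro ⟨T, D, hD⟩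
  obtain ⟨C, hC0, hC⟩ := hΦ.exists_lorentzPrimitive_le hΔ
  obtain ⟨w, hwm, hw0, hwn⟩ := exists_pos_orliczLorentzNorm_ne_top n 𝕜 hΦ hΔ
  have hwm' : Measurable fun x => (w x : 𝕜) := by fun_prop
  obtain ⟨h, hhm, hhi, hT⟩ := exists_integrable_evalFun hΔ hD hwm' hwn
  have hw0' : ∀ x, (w x : 𝕜) ≠ 0 := fun x => by exact_mod_cast (hw0 x).ne'
  let g : EuclideanSpace ℝ (Fin n) → 𝕜 := fun x => h x / w x
  have hgm : Measurable g := by fun_prop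
  have hwg : ∀ x, (w x : 𝕜) * g x = h x := fun x => mul_div_cancel₀ _ (hw0' x)
  have hTg : ∀ (b : EuclideanSpace ℝ (Fin n) → 𝕜) (c : ℝ), Measurable b → (∀ x, ‖b x‖ ≤ c) →
      evalFun T (fun x => (w x : 𝕜) * b x) = ∫ x, ((w x : 𝕜) * b x) * g x := by
    intro b c hb hbc
    rw [hT b c hb hbc]
    congr 1
    funext x
    rw [← hwg x]
    ring
  -- `D + 1` instead of `D` keeps the scale positive when `D = 0`.
  set l : ℝ≥0 := 2 * C * (D + 1) with hl
  have hl0 : 0 < l := by positivity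
  have hweak : ∀ t : ℝ≥0, 0 < t → complementaryFunction Φ t * distribFun g (l * t) ≤ 1 := by
    intro t ht
    refine weak_of_enorm_integral_le hΦ hΔ hC hwm hw0 hgm (by simpa only [hwg] using hhi)
      (by positivity) (fun b c hb hbc => ?_) ht
    rw [← hTg b c hb hbc]
    refine (enorm_evalFun_le hD _).trans ?_
    gcongr
    exact_mod_cast le_self_add
  have hgae := AEEqFun.coeFn_mk g hgm.aestronglyMeasurable (μ := volume)
  refine ⟨⟨AEEqFun.mk g hgm.aestronglyMeasurable,
    memWeakOrlicz_congr _ hgae.symm (memWeakOrlicz_of_weak hl0 hweak)⟩, ?_⟩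
  refine Subtype.ext (LinearMap.ext fun f => ?_)
  rw [weakOrliczPairing_apply]
  have hfm := (orliczLorentz.measurable_coe f)
  have hfg : Integrable fun x => f.1 x * g x :=
    integrable_mul_of_weak hΦ hΔ hfm (orliczLorentz.norm_ne_top f) hgm hl0 hweak
  have hcongr : ∫ x, f.1 x * (AEEqFun.mk g hgm.aestronglyMeasurable : _ →ₘ[volume] 𝕜) x
      = ∫ x, f.1 x * g x := by
    refine integral_congr_ae ?_
    filter_upwards [hgae] with x hx
    rw [hx]
  change ∫ x, f.1 x * (AEEqFun.mk g hgm.aestronglyMeasurable : _ →ₘ[volume] 𝕜) x = T f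
  rw [hcongr, ← evalFun_coe (T := T) f]
  -- truncation of `f` to the sets where it is dominated by multiples of `w`
  let A : ℕ → Set (EuclideanSpace ℝ (Fin n)) := fun j => {x | ‖f.1 x‖ ≤ j * w x}
  have hA : ∀ j, MeasurableSet (A j) := fun j =>
    measurableSet_le hfm.norm (by fun_prop)
  let u : ℕ → EuclideanSpace ℝ (Fin n) → 𝕜 := fun j => (A j).indicator f.1
  have hum : ∀ j, Measurable (u j) := fun j => hfm.indicator (hA j)
  have hule : ∀ j x, ‖u j x‖ ≤ ‖f.1 x‖ := fun j x => norm_indicator_le_norm_self _ _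
  have hulim : ∀ x, Tendsto (fun j => u j x) atTop (𝓝 (f.1 x)) := fun x => by
    refine tendsto_const_nhds.congr' ?_
    obtain ⟨N, hN⟩ := exists_nat_ge (‖f.1 x‖ / w x)
    filter_upwards [eventually_ge_atTop N] with j hj
    have : x ∈ A j := by
      have h1 : ‖f.1 x‖ / w x ≤ j := hN.trans (by exact_mod_cast hj)
      exact (div_le_iff₀ (hw0 x)).1 h1
    exact (indicator_of_mem this _).symm
  -- The truncation is `w` times a function bounded by `j`, so the formula for bounded multipliers
  -- applies.
  have hu : ∀ j, evalFun T (u j) = ∫ x, u j x * g x := fun j => by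
    let b : EuclideanSpace ℝ (Fin n) → 𝕜 := fun x => u j x / w x
    have hbm : Measurable b := (hum j).div hwm'
    have hb : ∀ x, (w x : 𝕜) * b x = u j x := fun x => mul_div_cancel₀ _ (hw0' x)
    have hbj : ∀ x, ‖b x‖ ≤ j := fun x => by
      simp only [b, norm_div, RCLike.norm_ofReal, abs_of_pos (hw0 x)]
      rw [div_le_iff₀ (hw0 x)]
      simp only [u]
      by_cases hx : x ∈ A j
      · rw [indicator_of_mem hx]
        exact hx
      · rw [indicator_of_notMem hx, norm_zero]
        exact mul_nonneg (Nat.cast_nonneg _) (hw0 x).le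
    simpa only [hb] using hTg b j hbm hbj
  have hL := tendsto_evalFun hΔ hD hfm hum hfm (orliczLorentz.norm_ne_top f) hule (fun _ => le_rfl) hulim
  have hR : Tendsto (fun j => ∫ x, u j x * g x) atTop (𝓝 (∫ x, f.1 x * g x)) := by
    refine tendsto_integral_of_dominated_convergence (fun x => ‖f.1 x * g x‖)
      (fun j => ((hum j).mul hgm).aestronglyMeasurable) hfg.norm
      (fun j => Eventually.of_forall fun x => ?_)
      (Eventually.of_forall fun x => (hulim x).mul_const _)
    rw [norm_mul, norm_mul]
    gcongr
    exact hule j x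
  exact tendsto_nhds_unique hR (hL.congr hu)

/-! ### Equivalence of the norms -/

theorem dualNorm_weakOrliczPairing_le (hΦ : IsYoungFunction Φ) (hΔ : DeltaTwo Φ)
    (g : weakOrlicz n 𝕜 (complementaryFunction Φ)) :
    dualNorm (weakOrliczPairing hΦ hΔ g).1
      ≤ (4 : ℝ≥0) * weakOrliczNorm (complementaryFunction Φ) g.1 := by
  have h4 : ((4 : ℝ≥0) : ℝ≥0∞) ≠ 0 := by simp
  unfold weakOrliczNorm
  rw [ENNReal.mul_iInf_of_ne h4 ENNReal.coe_ne_top]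
  refine le_iInf fun l => ?_
  rw [ENNReal.mul_iInf_of_ne h4 ENNReal.coe_ne_top]
  refine le_iInf fun ⟨hl, hg⟩ => ?_
  rw [← ENNReal.coe_mul]
  refine iInf₂_le (4 * l) fun f => (enorm_integral_le_lintegral_enorm _).trans ?_
  have := lintegral_enorm_mul_le_of_weak hΦ hΔ (orliczLorentz.measurable_coe f) (weakOrlicz.measurable_coe g) hl fun t ht => by
    rw [← distribFun_div g.1 hl]
    exact (le_iSup₂ (f := fun (t : ℝ≥0) (_ : 0 < t) => complementaryFunction Φ t *
      distribFun (fun x => g.1 x / ((l : ℝ) : 𝕜)) t) t ht).trans hg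
  exact_mod_cast this

theorem weakOrliczNorm_le_dualNorm (hΦ : IsYoungFunction Φ) (hΔ : DeltaTwo Φ) {C : ℝ≥0}
    (hC0 : 0 < C)
    (hC : ∀ s : ℝ≥0∞, s ≠ 0 → s ≠ ∞ → lorentzPrimitive Φ s ≤ C * (youngInv Φ (1 / s))⁻¹)
    (g : weakOrlicz n 𝕜 (complementaryFunction Φ)) :
    ((2 * C)⁻¹ : ℝ≥0) * weakOrliczNorm (complementaryFunction Φ) g.1
      ≤ dualNorm (weakOrliczPairing hΦ hΔ g).1 := by
  obtain ⟨w, hwm, hw0, hwn⟩ := exists_pos_orliczLorentzNorm_ne_top n 𝕜 hΦ hΔ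
  have hwm' : Measurable fun x => (w x : 𝕜) := by fun_prop
  refine le_iInf₂ fun D hD => ENNReal.le_of_forall_pos_le_add fun ε hε _ => ?_
  obtain ⟨l, hl, hgl⟩ := MemWeakOrlicz.exists_weak g.2
  -- The `ε` keeps the scale positive even for `D = 0`; it is arbitrary, so it costs nothing in the
  -- final constant.
  have h : weakOrliczNorm (complementaryFunction Φ) g.1 ≤ (2 * C * (D + ε) : ℝ≥0) := by
    refine weakOrliczNorm_le (by positivity) fun t ht => ?_
    refine weak_of_enorm_integral_le hΦ hΔ hC hwm hw0 (weakOrlicz.measurable_coe g)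
      (integrable_mul_of_weak hΦ hΔ hwm' hwn (weakOrlicz.measurable_coe g) hl hgl)
      (by positivity) (fun b c hb hbc => ?_) ht
    have hwbm : Measurable fun x => (w x : 𝕜) * b x := by fun_prop
    rw [← evalFun_weakOrliczPairing hΦ hΔ g hwbm (orliczLorentzNorm_mul_ne_top hwn hbc)]
    refine (enorm_evalFun_le hD _).trans ?_
    gcongr
    exact_mod_cast le_self_add
  calc (((2 * C)⁻¹ : ℝ≥0) : ℝ≥0∞) * weakOrliczNorm (complementaryFunction Φ) g.1
      ≤ ((2 * C)⁻¹ : ℝ≥0) * ((2 * C * (D + ε) : ℝ≥0) : ℝ≥0∞) := by gcongr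
    _ = D + ε := by
      rw [← ENNReal.coe_mul, inv_mul_cancel_left₀ (by positivity), ENNReal.coe_add]

end

theorem mainTheorem1 (n : ℕ) (𝕜 : Type*) [RCLike 𝕜] (Φ : ℝ≥0∞ → ℝ≥0∞)
    (hΦ : IsYoungFunction Φ) (hΔ : DeltaTwo Φ) :
    ∃ J : weakOrlicz n 𝕜 (complementaryFunction Φ) ≃ₗ[𝕜] orliczLorentzDual n 𝕜 hΦ,
      (∀ (g : weakOrlicz n 𝕜 (complementaryFunction Φ)) (f : orliczLorentz n 𝕜 hΦ),
        Integrable (fun x => f.1 x * g.1 x) volume ∧ (J g).1 f = ∫ x, f.1 x * g.1 x) ∧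
      ∃ c C : ℝ≥0, 0 < c ∧ 0 < C ∧ ∀ g : weakOrlicz n 𝕜 (complementaryFunction Φ),
        c * weakOrliczNorm (complementaryFunction Φ) g.1 ≤ dualNorm (J g).1 ∧
        dualNorm (J g).1 ≤ C * weakOrliczNorm (complementaryFunction Φ) g.1 := by
  obtain ⟨C, hC0, hC⟩ := hΦ.exists_lorentzPrimitive_le hΔ
  refine ⟨LinearEquiv.ofBijective (weakOrliczPairing hΦ hΔ)
    ⟨weakOrliczPairing_injective hΦ hΔ, weakOrliczPairing_surjective hΦ hΔ⟩,
    fun g f => ⟨integrable_mul hΦ hΔ f g, rfl⟩, (2 * C)⁻¹, 4, by positivity, by positivity,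
    fun g => ⟨weakOrliczNorm_le_dualNorm hΦ hΔ hC0 hC g, dualNorm_weakOrliczPairing_le hΦ hΔ g⟩⟩
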